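/- Let $\Gamma$ be a quantum graph with one internal edge, identified with $[0,l]$, $l>0$, and $M\ge 0$ infinite leads, identified with $[0,\infty)$. Its Hamiltonian $H$ acts as $-(\mathrm d/\mathrm dx+iA(x))^2$ on the internal edge, where $A\in C^1([0,l];\mathbb R)$ is the tangent component of the vector potential ($A=0$ is allowed), and as $-\mathrm d^2/\mathrm dx^2$ on the leads. The coupling is given by a unitary $(2+M)\times(2+M)$ matrix $U$ through $$(U-I)\Psi+i(U+I)(\Psi'+i\mathcal A\Psi)=0,\qquad \mathcal A=\mathrm{diag}(A(0),-A(l),0,\dots,0),$$ where $\Psi$ is the vector of boundary values at the two ends of the internal edge and at the origins of the leads, and $\Psi'$ is the vector of the corresponding derivatives, taken in the direction out of the vertex. A number $k\in\mathbb C\setminus\{0\}$ is called a resonance (in the momentum plane) if $H\psi=k^2\psi$ has a nontrivial solution that satisfies the coupling condition and is a multiple of $\mathrm e^{ikx}$ on every lead. Its multiplicity is its order as a zero of the characteristic determinant, i.e. of the determinant of the linear system that the coupling condition imposes on the coefficients of the elementary solutions $\mathrm e^{-i\int_0^xA}\,\mathrm e^{\pm ikx}$ on the internal edge and $\mathrm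 e^{ikx}$ on each lead. Let $N(R)$ be the number of resonances with $|k|<R$, counted with multiplicity. The graph is non-Weyl if $N(R)=\frac{2}{\pi}\mathcal W R+\mathcal O(1)$ as $R\to\infty$ for some $\mathcal W<l$. Put $U_A=\mathcal F U\mathcal F^{-1}$ with $\mathcal F=\mathrm{diag}(1,\mathrm e^{i\int_0^lA},1,\dots,1)$, and let $U_1,U_2,U_3,U_4$ be the blocks of $U_A$ with respect to the splitting $2+M$ into the ends of the internal edge and the leads. The effective coupling matrix is $$\tilde U(k)=(\tilde u_{ij}(k))_{i,j=1}^2=U_1-(1-k)U_2\,[(1-k)U_4-(k+1)I]^{-1}U_3,$$ defined for all $k\in\mathbb C$ for which $(1-k)U_4-(k+1)I$ is invertible. **Theorem.** Suppose that $\Gamma$ is non-Weyl and that $|\tilde u_{12}(k)|=|\tilde u_{21}(k)|$ for all $k\in\mathbb C$ for which $\tilde U(k)$ is defined. Then there is a magnetic field under whose influence the graph has at most finitely many resonances. More precisely, there is a flux $\Phi\in\mathbb R$ such that for every vector potential $A'\in C^1([0,l];\mathbb R)$ with $\int_0^lA'(x)\,\mathrm dx=\Phi$ the graph with the same length $l$,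 the same coupling matrix $U$ and the potential $A'$ in place of $A$ has at most finitely many resonances. -/

import Mathlib

open scoped Matrix

noncomputable section

/-- A magnetic quantum graph with one internal edge, identified with the interval `[0, length]`,
and `M` infinite leads, identified with half-lines `[0, ∞)`.  All vertices are joined together
("flower-like" description); the topology of the graph is encoded in the unitary coupling matrix.
The index `Sum.inl 0` stands for the starting point of the internal edge, `Sum.inl 1` for its
endpoint and `Sum.inr m` for the origin of the `m`-th lead.  The tangent component of the vector
potential is a continuously differentiable function on the internal edge and vanishes on the
leads. -/
structure OneEdgeQuantumGraph (M : ℕ) where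
  length : ℝ
  length_pos : 0 < length
  coupling : Matrix (Fin 2 ⊕ Fin M) (Fin 2 ⊕ Fin M) ℂ
  coupling_unitary : coupling ∈ Matrix.unitaryGroup (Fin 2 ⊕ Fin M) ℂ
  potential : ℝ → ℝ
  potential_contDiffOn : ContDiffOn ℝ 1 potential (Set.Icc 0 length)

namespace OneEdgeQuantumGraph

variable {M : ℕ}

/-- The same graph with the same coupling, under the influence of the vector potential `A`. -/
def withPotential (Γ : OneEdgeQuantumGraph M) (A : ℝ → ℝ)
    (hA : ContDiffOn ℝ 1 A (Set.Icc 0 Γ.length)) : OneEdgeQuantumGraph M where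
  length := Γ.length
  length_pos := Γ.length_pos
  coupling := Γ.coupling
  coupling_unitary := Γ.coupling_unitary
  potential := A
  potential_contDiffOn := hA

/-- The magnetic flux `∫₀ˡ A(x) dx`. -/
def flux (Γ : OneEdgeQuantumGraph M) : ℝ := ∫ x in (0 : ℝ)..Γ.length, Γ.potential x

/-- The magnetic derivative `f' + i A f` on the internal edge `[0, l]`, with one-sided derivatives
at the endpoints.  The Hamiltonian acts on the internal edge as minus its square. -/
def magDeriv (Γ : OneEdgeQuantumGraph M) (f : ℝ → ℂ) (x : ℝ) : ℂ :=
  derivWithin f (Set.Icc 0 Γ.length) x + Complex.I * (Γ.potential x : ℂ) * f x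

/-- The vector `Ψ` of boundary values of a function on the graph that is `f` on the internal edge
and `g m` on the leads. -/
def boundaryValue (Γ : OneEdgeQuantumGraph M) (f : ℝ → ℂ) (g : Fin M → ℝ → ℂ) :
    Fin 2 ⊕ Fin M → ℂ :=
  Sum.elim ![f 0, f Γ.length] (fun m => g m 0)

/-- The vector `Ψ'` of boundary derivatives, taken in the direction out of the vertex. -/
def boundaryDeriv (Γ : OneEdgeQuantumGraph M) (f : ℝ → ℂ) (g : Fin M → ℝ → ℂ) :
    Fin 2 ⊕ Fin M → ℂ :=
  Sum.elim ![derivWithin f (Set.Icc 0 Γ.length) 0, -derivWithin f (Set.Icc 0 Γ.length) Γ.length]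
    (fun m => derivWithin (g m) (Set.Ici 0) 0)

/-- The matrix `𝒜 = diag (A(0), -A(l), 0, …, 0)` of boundary values of the potential. -/
def boundaryPotential (Γ : OneEdgeQuantumGraph M) :
    Matrix (Fin 2 ⊕ Fin M) (Fin 2 ⊕ Fin M) ℂ :=
  Matrix.diagonal
    (Sum.elim ![(Γ.potential 0 : ℂ), -(Γ.potential Γ.length : ℂ)] (fun _ => 0))

/-- The left-hand side `(U - I) Ψ + i (U + I) (Ψ' + i 𝒜 Ψ)` of the coupling condition. -/
def couplingForm (Γ : OneEdgeQuantumGraph M) (f : ℝ → ℂ) (g : Fin M → ℝ → ℂ) :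
    Fin 2 ⊕ Fin M → ℂ :=
  (Γ.coupling - 1) *ᵥ Γ.boundaryValue f g +
    Complex.I • ((Γ.coupling + 1) *ᵥ
      (Γ.boundaryDeriv f g + Complex.I • (Γ.boundaryPotential *ᵥ Γ.boundaryValue f g)))

/-- `k ≠ 0` is a resonance (in the momentum plane) if the equation `H ψ = k² ψ` has a nontrivial
solution which satisfies the coupling condition and is outgoing, i.e. a multiple of `exp (i k x)`,
on every lead.  For `k` in the lower half-plane these are the true resonances, for real `k` the
embedded eigenvalues, and for `k` in the upper half-plane the isolated eigenvalues. -/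
def IsResonance (Γ : OneEdgeQuantumGraph M) (k : ℂ) : Prop :=
  k ≠ 0 ∧ ∃ (f : ℝ → ℂ) (g : Fin M → ℝ → ℂ),
    ContDiffOn ℝ 2 f (Set.Icc 0 Γ.length) ∧
    (∀ x ∈ Set.Icc 0 Γ.length, -Γ.magDeriv (Γ.magDeriv f) x = k ^ 2 * f x) ∧
    (∀ m, ∃ c : ℂ, ∀ x : ℝ, 0 ≤ x → g m x = c * Complex.exp (Complex.I * k * x)) ∧
    Γ.couplingForm f g = 0 ∧
    ((∃ x ∈ Set.Icc 0 Γ.length, f x ≠ 0) ∨ ∃ m, ∃ x : ℝ, 0 ≤ x ∧ g m x ≠ 0)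

/-- The set of resonances in the momentum plane. -/
def resonances (Γ : OneEdgeQuantumGraph M) : Set ℂ := {k | Γ.IsResonance k}

/-- The components on the internal edge of the elementary outgoing solutions:
`exp (-i ∫₀ˣ A) exp (± i k x)` for the first two, zero for those living on a lead. -/
def edgeSolution (Γ : OneEdgeQuantumGraph M) (k : ℂ) : Fin 2 ⊕ Fin M → ℝ → ℂ :=
  Sum.elim
    ![fun x => Complex.exp (-Complex.I * ((∫ t in (0 : ℝ)..x, Γ.potential t : ℝ) : ℂ)) *
        Complex.exp (Complex.I * k * x),
      fun x => Complex.exp (-Complex.I * ((∫ t in (0 : ℝ)..x, Γ.potential t : ℝ) : ℂ)) *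
        Complex.exp (-(Complex.I * k * x))]
    (fun _ _ => 0)

/-- The components on the leads of the elementary outgoing solutions: zero for the first two,
`exp (i k x)` on the `m`-th lead for the one that lives there. -/
def leadSolution (k : ℂ) : Fin 2 ⊕ Fin M → Fin M → ℝ → ℂ :=
  Sum.elim (fun _ _ _ => 0) (fun m m' x => if m' = m then Complex.exp (Complex.I * k * x) else 0)

/-- The characteristic determinant: its columns are the coupling forms of the elementary outgoing
solutions, so that its zeros `k ≠ 0` are the resonances. -/
def charDet (Γ : OneEdgeQuantumGraph M) (k : ℂ) : ℂ :=
  (Matrix.of fun i j => Γ.couplingForm (Γ.edgeSolution k j) (leadSolution k j) i).det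

/-- `N(R)`: the number of resonances in the disc of radius `R` around the origin of the momentum
plane, each counted with its multiplicity as a zero of the characteristic determinant. -/
def resonanceCount (Γ : OneEdgeQuantumGraph M) (R : ℝ) : ℕ :=
  ∑ᶠ k ∈ Γ.resonances ∩ Metric.ball 0 R, analyticOrderNatAt Γ.charDet k

/-- The graph has effective size `W`: `N(R) = (2 / π) W R + O(1)` as `R → ∞`. -/
def HasEffectiveSize (Γ : OneEdgeQuantumGraph M) (W : ℝ) : Prop :=
  (fun R : ℝ => (Γ.resonanceCount R : ℝ) - 2 / Real.pi * W * R) =O[Filter.atTop]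
    (fun _ => (1 : ℝ))

/-- The graph is non-Weyl: its effective size is smaller than the length of its internal part. -/
def IsNonWeyl (Γ : OneEdgeQuantumGraph M) : Prop :=
  ∃ W : ℝ, W < Γ.length ∧ Γ.HasEffectiveSize W

/-- The diagonal matrix `diag (1, exp (i Φ), 1, …, 1)` of the gauge transformation which removes
the potential. -/
def gaugeMatrix (Γ : OneEdgeQuantumGraph M) : Matrix (Fin 2 ⊕ Fin M) (Fin 2 ⊕ Fin M) ℂ :=
  Matrix.diagonal (Sum.elim ![1, Complex.exp (Complex.I * (Γ.flux : ℂ))] (fun _ => 1))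

/-- The coupling matrix `U_A = F U F⁻¹` after the potential has been removed by the gauge
transformation; it is `U` itself if there is no magnetic field. -/
def gaugedCoupling (Γ : OneEdgeQuantumGraph M) : Matrix (Fin 2 ⊕ Fin M) (Fin 2 ⊕ Fin M) ℂ :=
  Γ.gaugeMatrix * Γ.coupling * Γ.gaugeMatrix⁻¹

/-- The matrix `(1 - k) U₄ - (k + 1) I` on the leads. -/
def leadMatrix (Γ : OneEdgeQuantumGraph M) (k : ℂ) : Matrix (Fin M) (Fin M) ℂ :=
  (1 - k) • Γ.gaugedCoupling.toBlocks₂₂ - (k + 1) • 1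

/-- The effective energy-dependent coupling matrix
`Ũ(k) = U₁ - (1 - k) U₂ [(1 - k) U₄ - (k + 1) I]⁻¹ U₃` on the internal edge; it is defined
for those `k` for which `(1 - k) U₄ - (k + 1) I` is invertible. -/
def effectiveCoupling (Γ : OneEdgeQuantumGraph M) (k : ℂ) : Matrix (Fin 2) (Fin 2) ℂ :=
  Γ.gaugedCoupling.toBlocks₁₁ -
    (1 - k) • (Γ.gaugedCoupling.toBlocks₁₂ * (Γ.leadMatrix k)⁻¹ * Γ.gaugedCoupling.toBlocks₂₁)

end OneEdgeQuantumGraph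

end

/-!
Write `E = exp (ikl)` and let `Φ` be the flux. On the internal edge every solution is
`exp (-i ∫₀ˣ A) (a exp (ikx) + b exp (-ikx))`, so the coupling condition is a linear system in
`a`, `b` and the lead amplitudes. Its first two columns are affine in `exp (-iΦ) E` and
`exp (-iΦ) E⁻¹`, and multilinearity of the determinant gives (`charDet_eq_expPoly`)

  `charDet k = α(k) + exp (-2iΦ) β(k) + exp (-iΦ) (E p(k) + E⁻¹ q(k))`

with polynomials `α`, `β`, `p`, `q` that depend on the coupling matrix alone. By
`isResonance_iff` the resonances are the zeros `k ≠ 0` of this function.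

*Non-Weyl means `p = 0` or `q = 0`.* If both polynomials are nonzero, then `F = charDet` has
exponential type and `|F(iy) F(-iy)|` grows at least like `exp (2ly)`. On the other hand, if at most
`c t + C` zeros lie in the disc of radius `t`, then
`|F(iy) F(-iy)| ≤ |F(0)|² exp (π c y + C log (1 + y² / r₀²))` when `F(0) ≠ 0` and `r₀` is at most
the smallest modulus of a zero (`norm_mul_neg_le_of_count_le`). For this, divide `F` by the
factors `1 - z / s` of its zeros `s` in a disc of radius `ρ`; the quotient `h` satisfies
`h(z) h(-z) = h(0)² exp H(z)` with `H` even, `H(0) = 0` and `Re H = O(ρ)`, so `H(iy) = O(1/ρ)` by a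
second-order Borel–Carathéodory estimate, and for `ρ → ∞` only the product of the factors
`1 + y² / s²` remains, which Abel summation bounds by means of the counting function. Hence
`2l ≤ π c`, whereas `c = (2 / π) W` with `W < l` (`two_mul_le_of_count_le`).

*The other two coefficients can be cancelled.* A Schur complement shows that `α` and `β` are
`ũ₂₁` and `ũ₁₂` times the same function. Thus `|α| = |β|` on `ℂ`, the two polynomials are
proportional with a unimodular constant, and some flux `Φ` makes `α + exp (-2iΦ) β` vanish
(`exists_phase_of_norm_eval_eq`).

*What is left has finitely many zeros.* For this flux `charDet` is an exponential times a
polynomial. The polynomial is not zero, because `k = (π / l) (1 + i)` is never a zero of `charDet`: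
the unitary coupling matrix maps `Ψ + i (Ψ' + i 𝒜 Ψ)` to `Ψ - i (Ψ' + i 𝒜 Ψ)`, and at this `k` the
difference of their squared norms is a definite quadratic form in the amplitudes
(`charDet_ne_zero_at`).
-/

/-! ### Even products of entire functions with few zeros -/

theorem exists_eq_pow_mul_of_analyticOrderAt_eq {F : ℂ → ℂ} (hF : Differentiable ℂ F) {a : ℂ}
    {n : ℕ} (hn : analyticOrderAt F a = n) :
    ∃ g : ℂ → ℂ, Differentiable ℂ g ∧ g a ≠ 0 ∧ ∀ z, F z = (z - a) ^ n * g z := by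
  induction n generalizing F with
  | zero =>
    refine ⟨F, hF, ?_, by simp⟩
    exact (hF.analyticAt a).analyticOrderAt_eq_zero.1 (by simpa using hn)
  | succ n ih =>
    have hFa : F a = 0 := apply_eq_zero_of_analyticOrderAt_ne_zero (by simp [hn])
    have hd : Differentiable ℂ (dslope F a) := by
      rw [← differentiableOn_univ]
      exact (Complex.differentiableOn_dslope Filter.univ_mem).2 hF.differentiableOn
    have hmul : ∀ z, F z = (z - a) * dslope F a z := fun z => by
      simpa [hFa] using (sub_smul_dslope F a z).symm
    have hord : analyticOrderAt (dslope F a) a = n := by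
      have h1 : F = (fun z => z - a) • dslope F a := funext fun z => by simpa using hmul z
      have h2 := analyticOrderAt_smul (f := fun z : ℂ => z - a) (g := dslope F a) (z₀ := a)
        (by fun_prop) (hd.analyticAt a)
      rw [← h1, hn] at h2
      have h3 : analyticOrderAt (fun z : ℂ => z - a) a = 1 := by
        rw [show (1 : ℕ∞) = ((1 : ℕ) : ℕ∞) by norm_num,
          AnalyticAt.analyticOrderAt_eq_natCast (by fun_prop)]
        exact ⟨fun _ => 1, by fun_prop, by simp, by simp⟩
      rw [h3, add_comm, Nat.cast_add, Nat.cast_one] at h2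
      exact (ENat.add_right_injective_of_ne_top ENat.one_ne_top h2).symm
    obtain ⟨g, hg, hga, hgF⟩ := ih hd hord
    exact ⟨g, hg, hga, fun z => by rw [hmul, hgF, pow_succ]; ring⟩

theorem analyticOrderAt_mul_of_ne_zero {f g : ℂ → ℂ} {a : ℂ} (hf : AnalyticAt ℂ f a)
    (hg : AnalyticAt ℂ g a) (hfa : f a ≠ 0) :
    analyticOrderAt (fun z => f z * g z) a = analyticOrderAt g a := by
  have := analyticOrderAt_smul hf hg
  rw [hf.analyticOrderAt_eq_zero.2 hfa, zero_add] at this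
  exact this

/-- Normalizing the factors to `1 - z / s` makes the cofactor agree with `F` at `0`, whichever zeros
are split off. -/
theorem exists_eq_prod_mul {F : ℂ → ℂ} (hF : Differentiable ℂ F) (S : Finset ℂ)
    (h0 : (0 : ℂ) ∉ S) (hS : ∀ s ∈ S, analyticOrderAt F s ≠ ⊤) :
    ∃ h : ℂ → ℂ, Differentiable ℂ h ∧ (∀ s ∈ S, h s ≠ 0) ∧
      ∀ z, F z = (∏ s ∈ S, (1 - z / s) ^ analyticOrderNatAt F s) * h z := by
  induction S using Finset.induction_on with
  | empty => exact ⟨F, hF, by simp, by simp⟩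
  | insert a S ha ih =>
    obtain ⟨h, hh, hhS, hFh⟩ := ih (fun h => h0 (Finset.mem_insert_of_mem h))
      (fun s hs => hS s (Finset.mem_insert_of_mem hs))
    have ha0 : a ≠ 0 := fun h => h0 (h ▸ Finset.mem_insert_self a S)
    have hord : analyticOrderAt F a = analyticOrderAt h a := by
      have := analyticOrderAt_mul_of_ne_zero (a := a) (g := h)
        (f := fun z => ∏ s ∈ S, (1 - z / s) ^ analyticOrderNatAt F s) (by fun_prop)
        (hh.analyticAt a) ?_
      · rw [← this]; congr 1; exact funext hFh
      · refine Finset.prod_ne_zero_iff.2 fun s hs => pow_ne_zero _ ?_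
        have hs0 : s ≠ 0 := fun h => h0 (h ▸ Finset.mem_insert_of_mem hs)
        rw [sub_ne_zero]
        intro h
        exact ha ((div_eq_one_iff_eq hs0).1 h.symm ▸ hs)
    have htop := hS a (Finset.mem_insert_self a S)
    rw [← Nat.cast_analyticOrderNatAt htop] at hord
    obtain ⟨g, hg, hga, hgh⟩ := exists_eq_pow_mul_of_analyticOrderAt_eq hh hord.symm
    set n := analyticOrderNatAt F a
    refine ⟨fun z => (-a) ^ n * g z, by fun_prop, ?_, fun z => ?_⟩
    · intro s hs
      refine mul_ne_zero (pow_ne_zero _ (neg_ne_zero.2 ha0)) ?_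
      rcases Finset.mem_insert.1 hs with rfl | hs
      · exact hga
      · intro hgs
        exact hhS s hs (by rw [hgh, hgs, mul_zero])
    · rw [Finset.prod_insert ha, hFh z, hgh z]
      have : (1 - z / a) ^ n * (-a) ^ n = (z - a) ^ n := by
        rw [← mul_pow]; congr 1; field_simp; ring
      rw [← this]; ring

/-- A Borel–Carathéodory estimate for even functions. Evenness makes `H` vanish to second order at
`0`, hence the square of `‖z‖ / R`, without which the estimate would not tend to `0` when `M` grows
linearly in `R`. -/
theorem norm_le_of_even_of_re_le {H : ℂ → ℂ} {M R : ℝ} (hM : 0 < M)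
    (hH : DifferentiableOn ℂ H (Metric.ball 0 R))
    (hre : ∀ z ∈ Metric.ball (0 : ℂ) R, (H z).re ≤ M) (heven : ∀ z, H (-z) = H z)
    (h0 : H 0 = 0) {z : ℂ} (hz : z ∈ Metric.ball (0 : ℂ) R) :
    ‖H z‖ ≤ 2 * M * (‖z‖ / R) ^ 2 / (1 - (‖z‖ / R) ^ 2) := by
  have hR : 0 < R := Metric.nonempty_ball.mp ⟨_, hz⟩
  have hden : ∀ w ∈ Metric.ball (0 : ℂ) R, 2 * M - H w ≠ 0 := by
    intro w hw h
    have h1 := congrArg Complex.re h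
    have h2 := hre w hw
    simp at h1
    linarith
  -- `W` maps the ball into the unit disc, and `W 0 = deriv W 0 = 0`
  set W : ℂ → ℂ := fun w => H w / (2 * M - H w) with hW
  have hWd : DifferentiableOn ℂ W (Metric.ball 0 R) :=
    hH.div (hH.const_sub _) hden
  have hW0 : W 0 = 0 := by simp [hW, h0]
  have hWmaps : Set.MapsTo W (Metric.ball 0 R) (Metric.closedBall (W 0) 1) := by
    intro w hw
    rw [hW0, mem_closedBall_zero_iff, norm_div]
    refine div_le_one_of_le₀ ?_ (norm_nonneg _)
    have h2 := hre w hw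
    rw [← sq_le_sq₀ (norm_nonneg _) (norm_nonneg _), Complex.sq_norm, Complex.sq_norm,
      Complex.normSq_apply, Complex.normSq_apply]
    simp
    nlinarith
  have hderiv : HasDerivAt W 0 0 := by
    have h1 : DifferentiableAt ℂ W 0 := hWd.differentiableAt (Metric.ball_mem_nhds _ hR)
    have h2 := h1.hasDerivAt
    have h3 : HasDerivAt (fun w => W (-w)) (-deriv W 0) 0 := by
      have := HasDerivAt.scomp (𝕜 := ℂ) (x := (0 : ℂ)) (h := fun w => -w) (g₁ := W)
        (by simpa only [neg_zero] using h2) (hasDerivAt_neg 0)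
      rwa [neg_one_smul] at this
    have h4 : (fun w => W (-w)) = W := funext fun w => by simp [hW, heven]
    rw [h4] at h3
    have h5 := h3.unique h2
    have h6 : deriv W 0 = 0 := by
      have : (2 : ℂ) * deriv W 0 = 0 := by linear_combination -h5
      simpa using this
    rwa [h6] at h2
  have hlo : (fun w => W w - W 0) =o[nhds 0] (fun w : ℂ => ‖w - 0‖ ^ 1) := by
    have := (hasDerivAt_iff_isLittleO.1 hderiv).norm_right
    simpa using this
  have hS := Complex.dist_le_mul_div_pow_of_mapsTo_ball_of_isLittleO hWd hWmaps hlo hz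
  rw [hW0, dist_zero_right, dist_zero_right, one_mul] at hS
  norm_num at hS
  have hzR : ‖z‖ < R := mem_ball_zero_iff.1 hz
  set q := (‖z‖ / R) ^ 2 with hq
  have hq1 : q < 1 := by
    rw [hq, sq_lt_one_iff₀ (by positivity)]
    exact (div_lt_one hR).2 hzR
  have hHW : H z * (1 + W z) = 2 * M * W z := by
    have := hden z hz
    simp only [hW]; field_simp; ring
  have h1 : ‖H z‖ * (1 - q) ≤ 2 * M * q := by
    calc ‖H z‖ * (1 - q) ≤ ‖H z‖ * ‖1 + W z‖ := by
          gcongr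
          have := norm_sub_le_norm_add (1 : ℂ) (W z)
          simp only [norm_one] at this
          linarith
      _ = 2 * M * ‖W z‖ := by rw [← norm_mul, hHW]; simp [abs_of_pos hM]
      _ ≤ 2 * M * q := by gcongr
  rw [le_div_iff₀ (by linarith)]
  exact h1

theorem exists_eqOn_exp {G : ℂ → ℂ} {R : ℝ} (hR : 0 < R)
    (hG : DifferentiableOn ℂ G (Metric.ball 0 R))
    (hne : ∀ z ∈ Metric.ball (0 : ℂ) R, G z ≠ 0) (h0 : G 0 = 1) :
    ∃ H : ℂ → ℂ, DifferentiableOn ℂ H (Metric.ball 0 R) ∧ H 0 = 0 ∧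
      ∀ z ∈ Metric.ball (0 : ℂ) R, G z = Complex.exp (H z) := by
  have hd : DifferentiableOn ℂ (fun z => deriv G z / G z) (Metric.ball 0 R) :=
    (hG.deriv Metric.isOpen_ball).div hG hne
  obtain ⟨H, hH0, hH⟩ := hd.isExactOn_ball.with_val_at 0 0
  refine ⟨H, fun z hz => (hH z hz).differentiableAt.differentiableWithinAt, hH0, ?_⟩
  have hconst : ∀ z ∈ Metric.ball (0 : ℂ) R,
      HasDerivAt (fun z => G z * Complex.exp (-H z)) 0 z := by
    intro z hz
    have h1 := (hG.differentiableAt (Metric.isOpen_ball.mem_nhds hz)).hasDerivAt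
    have h2 := h1.mul (hH z hz).neg.cexp
    refine h2.congr_deriv ?_
    have := hne z hz
    field_simp
    ring
  intro z hz
  have := (convex_ball (0 : ℂ) R).is_const_of_fderivWithin_eq_zero (𝕜 := ℂ)
    (f := fun z => G z * Complex.exp (-H z))
    (fun z hz => (hconst z hz).differentiableAt.differentiableWithinAt)
    (fun z hz => by
      rw [fderivWithin_of_isOpen Metric.isOpen_ball hz]
      ext; simp [(hconst z hz).deriv]) hz (Metric.mem_ball_self hR)
  simp only [hH0, h0, neg_zero, Complex.exp_zero, mul_one] at this
  rw [Complex.exp_neg] at this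
  field_simp at this
  exact this

/-- For a zero-free `h = h(0) exp H`, the product `h(z) h(-z)` involves only the even function
`H(z) + H(-z)`. -/
theorem norm_mul_neg_le_of_ne_zero {h : ℂ → ℂ} {M R : ℝ} (hM : 0 < M) (hh : Differentiable ℂ h)
    (hne : ∀ z ∈ Metric.ball (0 : ℂ) R, h z ≠ 0)
    (hle : ∀ z ∈ Metric.ball (0 : ℂ) R, ‖h z‖ ≤ Real.exp M * ‖h 0‖) {z : ℂ}
    (hz : z ∈ Metric.ball (0 : ℂ) R) :
    ‖h z * h (-z)‖ ≤
      ‖h 0‖ ^ 2 * Real.exp (4 * M * (‖z‖ / R) ^ 2 / (1 - (‖z‖ / R) ^ 2)) := by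
  have hR : 0 < R := Metric.nonempty_ball.mp ⟨_, hz⟩
  have h0 : h 0 ≠ 0 := hne 0 (Metric.mem_ball_self hR)
  obtain ⟨H, hHd, hH0, hHexp⟩ := exists_eqOn_exp (G := fun z => h z / h 0) hR
    (hh.differentiableOn.div_const _) (fun z hz => div_ne_zero (hne z hz) h0) (div_self h0)
  have hneg : Set.MapsTo (fun z : ℂ => -z) (Metric.ball 0 R) (Metric.ball 0 R) := by
    intro w hw; simpa using hw
  have hre : ∀ w ∈ Metric.ball (0 : ℂ) R, (H w).re ≤ M := by
    intro w hw
    have h1 := hle w hw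
    have h2 : ‖h w / h 0‖ = Real.exp (H w).re := by rw [hHexp w hw, Complex.norm_exp]
    rw [norm_div, div_eq_iff (norm_ne_zero_iff.2 h0)] at h2
    rw [h2] at h1
    exact Real.exp_le_exp.1 (le_of_mul_le_mul_right h1 (norm_pos_iff.2 h0))
  have hev := norm_le_of_even_of_re_le (H := fun z => H z + H (-z)) (M := 2 * M) (R := R)
    (by positivity) (hHd.add (hHd.comp (by fun_prop) hneg)) (fun w hw => by
      have h1 := hre w hw
      have h2 := hre (-w) (hneg hw)
      simp only [Complex.add_re]; linarith) (fun w => by simp [add_comm]) (by simp [hH0]) hz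
  have hprod : h z * h (-z) = h 0 ^ 2 * Complex.exp (H z + H (-z)) := by
    rw [Complex.exp_add, ← hHexp z hz, ← hHexp (-z) (hneg hz)]
    field_simp
  rw [hprod, norm_mul, norm_pow, Complex.norm_exp]
  gcongr
  refine (Complex.re_le_norm _).trans (hev.trans (le_of_eq ?_))
  ring

/-- Abel summation: each term is `∫_{‖s‖}^∞ 2y² / (t (t² + y²)) dt`, so the sum is the integral of
the counting function against this kernel, and `∫₀^∞ 2y² / (t² + y²) dt = π y`. -/
theorem sum_log_one_add_le {S : Finset ℂ} {m : ℂ → ℕ} {r₀ c C y : ℝ} (hr₀ : 0 < r₀) (hy : 0 < y)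
    (hc : 0 ≤ c) (hS : ∀ s ∈ S, r₀ ≤ ‖s‖)
    (hcount : ∀ t : ℝ, 0 < t → ((∑ s ∈ S with ‖s‖ < t, m s : ℕ) : ℝ) ≤ c * t + C) :
    ∑ s ∈ S, (m s : ℝ) * Real.log (1 + y ^ 2 / ‖s‖ ^ 2) ≤
      Real.pi * c * y + C * Real.log (1 + y ^ 2 / r₀ ^ 2) := by
  set k : ℝ → ℝ := fun t => 2 * y ^ 2 / (t * (t ^ 2 + y ^ 2)) with hk
  have hk0 : ∀ t, 0 < t → 0 ≤ k t := fun t ht => by simp only [hk]; positivity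
  -- the primitive `-log (1 + y² / t²)`
  have hder : ∀ t, 0 < t →
      HasDerivAt (fun t : ℝ => -Real.log (1 + y ^ 2 / t ^ 2)) (k t) t := by
    intro t ht
    have h1 : HasDerivAt (fun t : ℝ => 1 + y ^ 2 / t ^ 2)
        ((0 * t ^ 2 - y ^ 2 * (2 * t)) / (t ^ 2) ^ 2) t := by
      have := ((hasDerivAt_const t (y ^ 2)).div (hasDerivAt_pow 2 t) (by positivity)).const_add 1
      simpa using this
    refine (h1.log (by positivity)).neg.congr_deriv ?_
    simp only [hk]
    field_simp
    ring
  have hlim : Filter.Tendsto (fun t : ℝ => -Real.log (1 + y ^ 2 / t ^ 2)) Filter.atTop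
      (nhds 0) := by
    have h1 : Filter.Tendsto (fun t : ℝ => 1 + y ^ 2 / t ^ 2) Filter.atTop (nhds (1 + 0)) :=
      tendsto_const_nhds.add
        (tendsto_const_nhds.div_atTop (Filter.tendsto_pow_atTop (by norm_num)))
    have h2 := ((Real.continuousAt_log (by norm_num)).tendsto.comp h1).neg
    simpa using h2
  have hint : ∀ r, 0 < r → MeasureTheory.IntegrableOn k (Set.Ioi r) ∧
      ∫ t in Set.Ioi r, k t = Real.log (1 + y ^ 2 / r ^ 2) := by
    intro r hr
    have hcont : ContinuousWithinAt (fun t : ℝ => -Real.log (1 + y ^ 2 / t ^ 2)) (Set.Ici r) r :=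
      (hder r hr).continuousAt.continuousWithinAt
    have hd' : ∀ t ∈ Set.Ioi r, HasDerivAt (fun t : ℝ => -Real.log (1 + y ^ 2 / t ^ 2)) (k t) t :=
      fun t ht => hder t (hr.trans ht)
    have hp : ∀ t ∈ Set.Ioi r, 0 ≤ k t := fun t ht => hk0 t (hr.trans ht)
    refine ⟨MeasureTheory.integrableOn_Ioi_deriv_of_nonneg hcont hd' hp hlim, ?_⟩
    rw [MeasureTheory.integral_Ioi_of_hasDerivAt_of_nonneg hcont hd' hp hlim]
    ring
  -- the primitive `2 y arctan (t / y)`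
  have hder' : ∀ t : ℝ, 0 < t →
      HasDerivAt (fun t : ℝ => 2 * y * Real.arctan (t / y)) (t * k t) t := by
    intro t ht
    have h1 := (((hasDerivAt_id t).div_const y).arctan).const_mul (2 * y)
    refine h1.congr_deriv ?_
    simp only [hk, id]
    field_simp
    ring
  have hlim' : Filter.Tendsto (fun t : ℝ => 2 * y * Real.arctan (t / y)) Filter.atTop
      (nhds (2 * y * (Real.pi / 2))) :=
    (((Real.tendsto_arctan_atTop.mono_right nhdsWithin_le_nhds).comp
      (Filter.tendsto_id.atTop_div_const hy))).const_mul _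
  have hint' : MeasureTheory.IntegrableOn (fun t => t * k t) (Set.Ioi r₀) ∧
      ∫ t in Set.Ioi r₀, t * k t ≤ Real.pi * y := by
    have hcont : ContinuousWithinAt (fun t : ℝ => 2 * y * Real.arctan (t / y)) (Set.Ici r₀) r₀ := by
      fun_prop
    have hd' : ∀ t ∈ Set.Ioi r₀,
        HasDerivAt (fun t : ℝ => 2 * y * Real.arctan (t / y)) (t * k t) t :=
      fun t ht => hder' t (hr₀.trans ht)
    have hp : ∀ t ∈ Set.Ioi r₀, 0 ≤ t * k t := fun t ht =>
      mul_nonneg (hr₀.trans ht).le (hk0 t (hr₀.trans ht))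
    refine ⟨MeasureTheory.integrableOn_Ioi_deriv_of_nonneg hcont hd' hp hlim', ?_⟩
    rw [MeasureTheory.integral_Ioi_of_hasDerivAt_of_nonneg hcont hd' hp hlim']
    have : 0 ≤ 2 * y * Real.arctan (r₀ / y) :=
      mul_nonneg (by positivity) (Real.arctan_nonneg.2 (by positivity))
    linarith
  have hi0 := (hint r₀ hr₀).1
  have hind : ∀ s ∈ S, MeasureTheory.IntegrableOn
      (fun t => (m s : ℝ) * (Set.Ioi ‖s‖).indicator k t) (Set.Ioi r₀) := fun s _ =>
    (hi0.indicator measurableSet_Ioi).const_mul _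
  calc ∑ s ∈ S, (m s : ℝ) * Real.log (1 + y ^ 2 / ‖s‖ ^ 2)
      = ∑ s ∈ S, ∫ t in Set.Ioi r₀, (m s : ℝ) * (Set.Ioi ‖s‖).indicator k t := by
        refine Finset.sum_congr rfl fun s hs => ?_
        rw [MeasureTheory.integral_const_mul,
          MeasureTheory.setIntegral_indicator measurableSet_Ioi,
          Set.inter_eq_right.2 (Set.Ioi_subset_Ioi (hS s hs)),
          (hint _ (hr₀.trans_le (hS s hs))).2]
    _ = ∫ t in Set.Ioi r₀, ∑ s ∈ S, (m s : ℝ) * (Set.Ioi ‖s‖).indicator k t :=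
        (MeasureTheory.integral_finsetSum _ hind).symm
    _ ≤ ∫ t in Set.Ioi r₀, (c * (t * k t) + C * k t) := by
        refine MeasureTheory.setIntegral_mono_on (MeasureTheory.integrable_finsetSum _ hind)
          ((hint'.1.const_mul _).add (hi0.const_mul _)) measurableSet_Ioi fun t ht => ?_
        have ht0 : 0 < t := hr₀.trans ht
        have h1 : ∑ s ∈ S, (m s : ℝ) * (Set.Ioi ‖s‖).indicator k t =
            ((∑ s ∈ S with ‖s‖ < t, m s : ℕ) : ℝ) * k t := by
          rw [Finset.sum_filter, Nat.cast_sum, Finset.sum_mul]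
          refine Finset.sum_congr rfl fun s _ => ?_
          by_cases hst : ‖s‖ < t <;> simp [hst]
        rw [h1]
        calc _ ≤ (c * t + C) * k t := by
              gcongr
              exact hcount t ht0
          _ = _ := by ring
    _ = c * (∫ t in Set.Ioi r₀, t * k t) + C * ∫ t in Set.Ioi r₀, k t := by
        rw [MeasureTheory.integral_add (hint'.1.const_mul _) (hi0.const_mul _),
          MeasureTheory.integral_const_mul, MeasureTheory.integral_const_mul]
    _ ≤ c * (Real.pi * y) + C * Real.log (1 + y ^ 2 / r₀ ^ 2) := by
        rw [(hint r₀ hr₀).2]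
        gcongr
        exact hint'.2
    _ = _ := by ring

theorem finite_zeros_inter_closedBall {F : ℂ → ℂ} (hF : Differentiable ℂ F) {w : ℂ} (hw : F w ≠ 0)
    (R : ℝ) : ({z | F z = 0} ∩ Metric.closedBall 0 R).Finite := by
  by_contra hinf
  obtain ⟨z, -, hz⟩ := Set.Infinite.exists_accPt_of_subset_isCompact hinf
    (isCompact_closedBall (0 : ℂ) R) Set.inter_subset_right
  rw [accPt_iff_frequently_nhdsNE] at hz
  have han : AnalyticOnNhd ℂ F Set.univ := hF.differentiableOn.analyticOnNhd isOpen_univ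
  have := han.eqOn_zero_of_preconnected_of_frequently_eq_zero
    isPreconnected_univ (Set.mem_univ z) (hz.mono fun x hx => hx.1)
  exact hw (this (Set.mem_univ w))

theorem analyticOrderAt_ne_top_of_exists_ne_zero {F : ℂ → ℂ} (hF : Differentiable ℂ F) {w : ℂ}
    (hw : F w ≠ 0) (z : ℂ) : analyticOrderAt F z ≠ ⊤ := by
  intro h
  rw [analyticOrderAt_eq_top] at h
  have han : AnalyticOnNhd ℂ F Set.univ := hF.differentiableOn.analyticOnNhd isOpen_univ
  have := han.eqOn_zero_of_preconnected_of_eventuallyEq_zero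
    isPreconnected_univ (Set.mem_univ z) h
  exact hw (this (Set.mem_univ w))

/-- A function of exponential type with few zeros is small on the imaginary axis, in the sense that
`F(iy) F(-iy)` is bounded in terms of `F(0)` and the zero count. The constant `A` of the
growth bound does not enter the conclusion. -/
theorem norm_mul_neg_le_of_count_le {F : ℂ → ℂ} (hF : Differentiable ℂ F) (hF0 : F 0 ≠ 0)
    {A c C r₀ y : ℝ} (hA : 0 < A) (hgrowth : ∀ z, ‖F z‖ ≤ Real.exp (A * (‖z‖ + 1)))
    (hc : 0 ≤ c) (hr₀ : 0 < r₀) (hzero : ∀ s, F s = 0 → r₀ ≤ ‖s‖)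
    (hcount : ∀ t : ℝ, 0 < t →
      ((∑ᶠ s ∈ {s | F s = 0} ∩ Metric.ball 0 t, analyticOrderNatAt F s : ℕ) : ℝ) ≤ c * t + C)
    (hy : 0 < y) :
    ‖F (Complex.I * y) * F (-(Complex.I * y))‖ ≤
      ‖F 0‖ ^ 2 * Real.exp (Real.pi * c * y + C * Real.log (1 + y ^ 2 / r₀ ^ 2)) := by
  set M : ℝ → ℝ := fun ρ => A * (2 * ρ + 1) + |Real.log ‖F 0‖| with hM
  have hF0' : 0 < ‖F 0‖ := norm_pos_iff.2 hF0
  have hyn : ‖Complex.I * (y : ℂ)‖ = y := by simp [abs_of_pos hy]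
  have key : ∀ ρ, y < ρ → ‖F (Complex.I * y) * F (-(Complex.I * y))‖ ≤
      ‖F 0‖ ^ 2 * Real.exp (4 * M ρ * (y / ρ) ^ 2 / (1 - (y / ρ) ^ 2)) *
        Real.exp (Real.pi * c * y + C * Real.log (1 + y ^ 2 / r₀ ^ 2)) := by
    intro ρ hρ
    have hρ0 : 0 < ρ := hy.trans hρ
    have hfin : ({s | F s = 0} ∩ Metric.ball 0 ρ).Finite :=
      (finite_zeros_inter_closedBall hF hF0 ρ).subset
        (Set.inter_subset_inter_right _ Metric.ball_subset_closedBall)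
    set S := hfin.toFinset with hSdef
    have hmemS : ∀ s, s ∈ S ↔ F s = 0 ∧ ‖s‖ < ρ := fun s => by simp [hSdef]
    have hS0 : (0 : ℂ) ∉ S := fun h => hF0 ((hmemS 0).1 h).1
    obtain ⟨h, hh, hhS, hFh⟩ := exists_eq_prod_mul hF S hS0
      (fun s _ => analyticOrderAt_ne_top_of_exists_ne_zero hF hF0 s)
    have hh0 : h 0 = F 0 := by simp [hFh 0]
    have hhne : ∀ z ∈ Metric.ball (0 : ℂ) ρ, h z ≠ 0 := by
      intro z hz hhz
      refine hhS z ((hmemS z).2 ⟨?_, mem_ball_zero_iff.1 hz⟩) hhz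
      rw [hFh z, hhz, mul_zero]
    -- on the sphere of radius `2ρ` the factors have modulus at least `1`
    have hsphere : ∀ z : ℂ, ‖z‖ = 2 * ρ → ‖h z‖ ≤ Real.exp (A * (2 * ρ + 1)) := by
      intro z hz
      have h1 : 1 ≤ ‖∏ s ∈ S, (1 - z / s) ^ analyticOrderNatAt F s‖ := by
        rw [norm_prod]
        refine Finset.prod_induction _ (1 ≤ ·) (fun _ _ => one_le_mul_of_one_le_of_one_le) le_rfl
          fun s hs => ?_
        rw [norm_pow]
        refine one_le_pow₀ ?_
        have hs1 := ((hmemS s).1 hs).2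
        have hs0 : 0 < ‖s‖ := norm_pos_iff.2 fun h => hS0 (h ▸ hs)
        have h2 : 2 ≤ ‖z / s‖ := by
          rw [norm_div, le_div_iff₀ hs0, hz]; linarith
        have h3 := norm_sub_norm_le (z / s) 1
        rw [norm_one, norm_sub_rev] at h3
        linarith
      calc ‖h z‖ ≤ ‖∏ s ∈ S, (1 - z / s) ^ analyticOrderNatAt F s‖ * ‖h z‖ :=
            le_mul_of_one_le_left (norm_nonneg _) h1
        _ = ‖F z‖ := by rw [hFh z, norm_mul]
        _ ≤ _ := by simpa [hz] using hgrowth z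
    have hbound : ∀ z ∈ Metric.ball (0 : ℂ) ρ, ‖h z‖ ≤ Real.exp (M ρ) * ‖h 0‖ := by
      intro z hz
      have h1 : ‖h z‖ ≤ Real.exp (A * (2 * ρ + 1)) := by
        refine Complex.norm_le_of_forall_mem_frontier_norm_le (U := Metric.ball 0 (2 * ρ))
          Metric.isBounded_ball hh.diffContOnCl (fun w hw => ?_)
          (subset_closure (Metric.ball_subset_ball (by linarith) hz))
        rw [frontier_ball _ (by positivity)] at hw
        exact hsphere w (mem_sphere_zero_iff_norm.1 hw)
      refine h1.trans ?_
      rw [hh0]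
      conv_rhs => rw [← Real.exp_log hF0', ← Real.exp_add]
      refine Real.exp_le_exp.2 ?_
      simp only [hM]
      linarith [neg_abs_le (Real.log ‖F 0‖)]
    have hmain := norm_mul_neg_le_of_ne_zero (M := M ρ) (R := ρ) (by positivity) hh hhne hbound
      (z := Complex.I * y) (by rw [mem_ball_zero_iff, hyn]; exact hρ)
    rw [hyn, hh0] at hmain
    have hpr : ‖(∏ s ∈ S, (1 - Complex.I * y / s) ^ analyticOrderNatAt F s) *
        ∏ s ∈ S, (1 - -(Complex.I * y) / s) ^ analyticOrderNatAt F s‖ ≤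
        Real.exp (Real.pi * c * y + C * Real.log (1 + y ^ 2 / r₀ ^ 2)) := by
      have hlog := sum_log_one_add_le (S := S) (m := analyticOrderNatAt F) (c := c) (C := C)
        hr₀ hy hc (fun s hs => hzero s ((hmemS s).1 hs).1) (fun t ht => by
          refine le_trans ?_ (hcount t ht)
          have hfint : ({s | F s = 0} ∩ Metric.ball 0 t).Finite :=
            (finite_zeros_inter_closedBall hF hF0 t).subset
              (Set.inter_subset_inter_right _ Metric.ball_subset_closedBall)
          rw [finsum_mem_eq_finite_toFinset_sum _ hfint]
          refine Nat.cast_le.2 (Finset.sum_le_sum_of_subset fun s hs => ?_)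
          rw [Finset.mem_filter, hmemS] at hs
          simp [hs.1.1, hs.2])
      refine le_trans ?_ (Real.exp_le_exp.2 hlog)
      rw [← Finset.prod_mul_distrib, norm_prod, Real.exp_sum]
      refine Finset.prod_le_prod (fun _ _ => norm_nonneg _) fun s hs => ?_
      rw [← mul_pow, norm_pow, Real.exp_nat_mul, Real.exp_log (by positivity)]
      gcongr
      have h2 : (1 - Complex.I * y / s) * (1 - -(Complex.I * y) / s) = 1 + (y / s) ^ 2 := by
        linear_combination (-(y / s : ℂ) ^ 2) * Complex.I_sq
      rw [h2]
      refine (norm_add_le _ _).trans (le_of_eq ?_)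
      simp [div_pow]
    calc ‖F (Complex.I * y) * F (-(Complex.I * y))‖
        = ‖h (Complex.I * y) * h (-(Complex.I * y))‖ *
          ‖(∏ s ∈ S, (1 - Complex.I * y / s) ^ analyticOrderNatAt F s) *
          ∏ s ∈ S, (1 - -(Complex.I * y) / s) ^ analyticOrderNatAt F s‖ := by
          rw [hFh (Complex.I * y), hFh (-(Complex.I * y)), ← norm_mul]; congr 1; ring
      _ ≤ _ := by gcongr
  have hlim : Filter.Tendsto (fun ρ : ℝ => 4 * M ρ * (y / ρ) ^ 2 / (1 - (y / ρ) ^ 2)) Filter.atTop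
      (nhds 0) := by
    have h1 : Filter.Tendsto (fun ρ : ℝ => ρ⁻¹) Filter.atTop (nhds 0) := tendsto_inv_atTop_zero
    have h2 : Filter.Tendsto (fun ρ : ℝ => 4 * (A * 2 * (y ^ 2 * ρ⁻¹) +
        (A + |Real.log ‖F 0‖|) * (y * ρ⁻¹) ^ 2) / (1 - (y * ρ⁻¹) ^ 2)) Filter.atTop
        (nhds (4 * (A * 2 * (y ^ 2 * 0) +
        (A + |Real.log ‖F 0‖|) * (y * 0) ^ 2) / (1 - (y * 0) ^ 2))) := by
      refine Filter.Tendsto.div ?_ ?_ (by simp)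
      · exact (((h1.const_mul _).const_mul _).add
          (((h1.const_mul _).pow 2).const_mul _)).const_mul _
      · exact tendsto_const_nhds.sub ((h1.const_mul _).pow 2)
    simp only [mul_zero, ne_eq, OfNat.ofNat_ne_zero, not_false_eq_true, zero_pow, add_zero,
      zero_div] at h2
    refine h2.congr' ?_
    filter_upwards [Filter.eventually_gt_atTop 0] with ρ hρ
    simp only [hM, div_eq_mul_inv]
    congr 1
    field_simp
    ring
  have hlim2 : Filter.Tendsto (fun ρ : ℝ => ‖F 0‖ ^ 2 *
      Real.exp (4 * M ρ * (y / ρ) ^ 2 / (1 - (y / ρ) ^ 2)) *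
        Real.exp (Real.pi * c * y + C * Real.log (1 + y ^ 2 / r₀ ^ 2))) Filter.atTop
      (nhds (‖F 0‖ ^ 2 * Real.exp 0 *
        Real.exp (Real.pi * c * y + C * Real.log (1 + y ^ 2 / r₀ ^ 2)))) :=
    (((Real.continuous_exp.tendsto 0).comp hlim).const_mul _).mul_const _
  rw [Real.exp_zero, mul_one] at hlim2
  refine ge_of_tendsto hlim2 ?_
  filter_upwards [Filter.eventually_gt_atTop y] with ρ hρ using key ρ hρ

/-! ### Zeros of exponential polynomials -/

theorem Polynomial.exists_norm_eval_le_mul_exp (p : Polynomial ℂ) :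
    ∃ K : ℝ, 0 < K ∧ ∀ z : ℂ, ‖p.eval z‖ ≤ K * Real.exp ‖z‖ := by
  induction p using Polynomial.induction_on' with
  | add p q hp hq =>
    obtain ⟨K, hK, hp⟩ := hp
    obtain ⟨L, hL, hq⟩ := hq
    refine ⟨K + L, by positivity, fun z => ?_⟩
    rw [Polynomial.eval_add, add_mul]
    exact (norm_add_le _ _).trans (add_le_add (hp z) (hq z))
  | monomial n a =>
    refine ⟨(‖a‖ + 1) * n.factorial, by positivity, fun z => ?_⟩
    rw [Polynomial.eval_monomial, norm_mul, norm_pow, mul_assoc]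
    have h := Real.pow_div_factorial_le_exp ‖z‖ (norm_nonneg z) n
    rw [div_le_iff₀ (by positivity), mul_comm] at h
    gcongr
    linarith

theorem Polynomial.tendsto_exp_neg_mul_norm_eval (p : Polynomial ℂ) {b : ℝ} (hb : 0 < b) {u : ℂ}
    (hu : ‖u‖ = 1) :
    Filter.Tendsto (fun y : ℝ => Real.exp (-(b * y)) * ‖p.eval (u * y)‖) Filter.atTop
      (nhds 0) := by
  induction p using Polynomial.induction_on' with
  | add p q hp hq =>
    refine squeeze_zero (fun y => by positivity) (fun y => ?_) (by simpa using hp.add hq)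
    rw [Polynomial.eval_add, ← mul_add]
    gcongr
    exact norm_add_le _ _
  | monomial n a =>
    have h := (Real.tendsto_pow_mul_exp_neg_atTop_nhds_zero n).comp
      (Filter.tendsto_id.const_mul_atTop hb)
    have h2 := h.const_mul (‖a‖ / b ^ n)
    rw [mul_zero] at h2
    refine h2.congr' ?_
    filter_upwards [Filter.eventually_gt_atTop 0] with y hy
    simp only [Function.comp, id, Polynomial.eval_monomial, norm_mul, norm_pow, hu,
      Complex.norm_real, Real.norm_eq_abs, abs_of_pos hy, mul_pow, one_pow, one_mul]
    field_simp

theorem Polynomial.exists_le_norm_eval {p : Polynomial ℂ} (hp : p ≠ 0) {u : ℂ} (hu : ‖u‖ = 1) :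
    ∃ δ : ℝ, 0 < δ ∧ ∀ᶠ y : ℝ in Filter.atTop, δ ≤ ‖p.eval (u * y)‖ := by
  rcases Nat.eq_zero_or_pos p.natDegree with h | h
  · rw [Polynomial.eq_C_of_natDegree_eq_zero h] at hp ⊢
    exact ⟨‖p.coeff 0‖, norm_pos_iff.2 (by simpa using hp), by simp⟩
  · have ht : Filter.Tendsto (fun y : ℝ => ‖u * (y : ℂ)‖) Filter.atTop Filter.atTop := by
      simpa [hu] using Filter.tendsto_abs_atTop_atTop
    have := p.tendsto_norm_atTop (Polynomial.natDegree_pos_iff_degree_pos.1 h) ht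
    exact ⟨1, one_pos, this.eventually_ge_atTop 1⟩

/-- The exponential polynomial `r(k) + exp(ikl) p(k) + exp(-ikl) q(k)`. -/
noncomputable def expPoly (l : ℝ) (p q r : Polynomial ℂ) (k : ℂ) : ℂ :=
  r.eval k + Complex.exp (Complex.I * k * l) * p.eval k +
    Complex.exp (-(Complex.I * k * l)) * q.eval k

theorem differentiable_expPoly (l : ℝ) (p q r : Polynomial ℂ) :
    Differentiable ℂ (expPoly l p q r) := by
  unfold expPoly
  have := p.differentiable
  have := q.differentiable
  have := r.differentiable
  fun_prop

theorem expPoly_neg (l : ℝ) (p q r : Polynomial ℂ) (k : ℂ) :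
    expPoly l p q r (-k) = expPoly l (q.comp (-Polynomial.X)) (p.comp (-Polynomial.X))
      (r.comp (-Polynomial.X)) k := by
  simp only [expPoly, Polynomial.eval_comp, Polynomial.eval_neg, Polynomial.eval_X]
  ring_nf

theorem exists_norm_expPoly_le {l : ℝ} (hl : 0 < l) (p q r : Polynomial ℂ) :
    ∃ A : ℝ, 0 < A ∧ ∀ z, ‖expPoly l p q r z‖ ≤ Real.exp (A * (‖z‖ + 1)) := by
  obtain ⟨K₁, hK₁, hp⟩ := p.exists_norm_eval_le_mul_exp
  obtain ⟨K₂, hK₂, hq⟩ := q.exists_norm_eval_le_mul_exp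
  obtain ⟨K₃, hK₃, hr⟩ := r.exists_norm_eval_le_mul_exp
  refine ⟨l + 1 + (K₁ + K₂ + K₃), by positivity, fun z => ?_⟩
  have hexp : ∀ w : ℂ, ‖w‖ = ‖z‖ * l → ‖Complex.exp w‖ ≤ Real.exp (l * ‖z‖) := by
    intro w hw
    rw [Complex.norm_exp]
    refine Real.exp_le_exp.2 ((Complex.re_le_norm w).trans_eq ?_)
    rw [hw, mul_comm]
  have h1 := hexp (Complex.I * z * l) (by simp [abs_of_pos hl])
  have h2 := hexp (-(Complex.I * z * l)) (by simp [abs_of_pos hl])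
  have hone : 1 ≤ Real.exp (l * ‖z‖) := Real.one_le_exp (by positivity)
  calc ‖expPoly l p q r z‖ ≤ K₃ * Real.exp ‖z‖ + Real.exp (l * ‖z‖) * (K₁ * Real.exp ‖z‖) +
        Real.exp (l * ‖z‖) * (K₂ * Real.exp ‖z‖) := by
        unfold expPoly
        refine (norm_add₃_le).trans ?_
        rw [norm_mul, norm_mul]
        gcongr
        exacts [hr z, hp z, hq z]
    _ ≤ Real.exp (l * ‖z‖) * (K₃ * Real.exp ‖z‖) + Real.exp (l * ‖z‖) * (K₁ * Real.exp ‖z‖) +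
        Real.exp (l * ‖z‖) * (K₂ * Real.exp ‖z‖) := by
        have := le_mul_of_one_le_left (b := K₃ * Real.exp ‖z‖) (by positivity) hone
        linarith
    _ = (K₁ + K₂ + K₃) * Real.exp ((l + 1) * ‖z‖) := by
        rw [add_mul l, one_mul, Real.exp_add]; ring
    _ ≤ Real.exp (K₁ + K₂ + K₃) * Real.exp ((l + 1) * ‖z‖) := by
        gcongr
        linarith [Real.add_one_le_exp (K₁ + K₂ + K₃)]
    _ ≤ _ := by
        rw [← Real.exp_add]
        refine Real.exp_le_exp.2 ?_
        nlinarith [norm_nonneg z, mul_nonneg (add_pos (add_pos hK₁ hK₂) hK₃).le (norm_nonneg z)]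

theorem exists_le_norm_expPoly {l : ℝ} (hl : 0 < l) (p : Polynomial ℂ) {q : Polynomial ℂ}
    (r : Polynomial ℂ) (hq : q ≠ 0) :
    ∃ δ : ℝ, 0 < δ ∧ ∀ᶠ y : ℝ in Filter.atTop,
      δ * Real.exp (l * y) ≤ ‖expPoly l p q r (Complex.I * y)‖ := by
  obtain ⟨δ, hδ, hqδ⟩ := q.exists_le_norm_eval hq Complex.norm_I
  refine ⟨δ / 2, by positivity, ?_⟩
  have hp0 := p.tendsto_exp_neg_mul_norm_eval (b := 2 * l) (by positivity) Complex.norm_I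
  have hr0 := r.tendsto_exp_neg_mul_norm_eval hl Complex.norm_I
  filter_upwards [hqδ, hp0.eventually_lt_const (show 0 < δ / 4 by positivity),
    hr0.eventually_lt_const (show 0 < δ / 4 by positivity)] with y h1 h2 h3
  have he1 : ‖Complex.exp (Complex.I * (Complex.I * y) * l)‖ = Real.exp (-(l * y)) := by
    rw [Complex.norm_exp, ← mul_assoc, Complex.I_mul_I]; simp [mul_comm]
  have he2 : ‖Complex.exp (-(Complex.I * (Complex.I * y) * l))‖ = Real.exp (l * y) := by
    rw [Complex.norm_exp, ← mul_assoc, Complex.I_mul_I]; simp [mul_comm]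
  have htri : ‖Complex.exp (-(Complex.I * (Complex.I * y) * l)) * q.eval (Complex.I * y)‖ ≤
      ‖expPoly l p q r (Complex.I * y)‖ + ‖r.eval (Complex.I * y)‖ +
      ‖Complex.exp (Complex.I * (Complex.I * y) * l) * p.eval (Complex.I * y)‖ := by
    have : Complex.exp (-(Complex.I * (Complex.I * y) * l)) * q.eval (Complex.I * y) =
      expPoly l p q r (Complex.I * y) - r.eval (Complex.I * y) -
        Complex.exp (Complex.I * (Complex.I * y) * l) * p.eval (Complex.I * y) := by
      unfold expPoly; ring
    rw [this]
    exact (norm_sub_le _ _).trans (add_le_add_left (norm_sub_le _ _) _)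
  rw [norm_mul, norm_mul, he1, he2] at htri
  have hE := Real.exp_pos (l * y)
  have h3' : ‖r.eval (Complex.I * y)‖ ≤ δ / 4 * Real.exp (l * y) := by
    rw [Real.exp_neg, inv_mul_lt_iff₀ hE] at h3
    linarith
  have h2' : Real.exp (-(l * y)) * ‖p.eval (Complex.I * y)‖ ≤ δ / 4 * Real.exp (l * y) := by
    have : Real.exp (-(l * y)) = Real.exp (-(2 * l * y)) * Real.exp (l * y) := by
      rw [← Real.exp_add]; ring_nf
    rw [this]
    nlinarith
  have h1' : Real.exp (l * y) * δ ≤ Real.exp (l * y) * ‖q.eval (Complex.I * y)‖ := by gcongr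
  nlinarith

/-- If both exponentials are present, then zeros other than `0` cannot be sparser than
`(2 / π) l t`. The possible zero at `0` is divided out. -/
theorem two_mul_le_of_count_le {l : ℝ} (hl : 0 < l) {p q : Polynomial ℂ} (r : Polynomial ℂ)
    (hp : p ≠ 0) (hq : q ≠ 0) {c C : ℝ} (hc : 0 ≤ c)
    (hcount : ∀ t : ℝ, 0 < t →
      ((∑ᶠ s ∈ {s | s ≠ 0 ∧ expPoly l p q r s = 0} ∩ Metric.ball 0 t,
        analyticOrderNatAt (expPoly l p q r) s : ℕ) : ℝ) ≤ c * t + C) :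
    2 * l ≤ Real.pi * c := by
  set F := expPoly l p q r with hFdef
  have hF : Differentiable ℂ F := differentiable_expPoly l p q r
  obtain ⟨δ₁, hδ₁, hlow₁⟩ := exists_le_norm_expPoly hl p r hq
  obtain ⟨δ₂, hδ₂, hlow₂⟩ := exists_le_norm_expPoly hl (q.comp (-Polynomial.X))
    (q := p.comp (-Polynomial.X)) (r.comp (-Polynomial.X)) (by
      rw [Ne, Polynomial.comp_eq_zero_iff]
      rintro (h | ⟨-, h⟩)
      · exact hp h
      · have := congrArg (Polynomial.coeff · 1) h
        simp at this)
  simp only [← expPoly_neg] at hlow₂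
  obtain ⟨w, hw⟩ : ∃ w, F w ≠ 0 := by
    obtain ⟨y, hy⟩ := hlow₁.exists
    exact ⟨_, norm_pos_iff.1 (lt_of_lt_of_le (by positivity) hy)⟩
  obtain ⟨G, hG, hG0, hFG⟩ := exists_eq_pow_mul_of_analyticOrderAt_eq hF
    (Nat.cast_analyticOrderNatAt (analyticOrderAt_ne_top_of_exists_ne_zero hF hw 0)).symm
  set m := analyticOrderNatAt F 0
  simp only [sub_zero] at hFG
  have hzeros : {s | s ≠ 0 ∧ F s = 0} = {s | G s = 0} := by
    ext s
    simp only [Set.mem_ofPred_eq, hFG s, mul_eq_zero]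
    constructor
    · rintro ⟨h0, h | h⟩
      · exact absurd (eq_zero_of_pow_eq_zero h) h0
      · exact h
    · intro h
      exact ⟨fun h0 => hG0 (h0 ▸ h), Or.inr h⟩
  have hord : ∀ s, G s = 0 → analyticOrderNatAt F s = analyticOrderNatAt G s := by
    intro s hs
    have hs0 : s ≠ 0 := fun h => hG0 (h ▸ hs)
    have := analyticOrderAt_mul_of_ne_zero (f := fun z : ℂ => z ^ m) (a := s) (by fun_prop)
      (hG.analyticAt s) (pow_ne_zero _ hs0)
    rw [analyticOrderNatAt, analyticOrderNatAt, ← this]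
    congr 2
    exact funext hFG
  rw [hzeros] at hcount
  obtain ⟨A, hA, hFA⟩ := exists_norm_expPoly_le hl p q r
  have hGA : ∀ z, ‖G z‖ ≤ Real.exp (2 * A * (‖z‖ + 1)) := by
    have hout : ∀ z : ℂ, 1 ≤ ‖z‖ → ‖G z‖ ≤ Real.exp (A * (‖z‖ + 1)) := by
      intro z hz
      refine le_trans ?_ (hFA z)
      rw [← hFdef, hFG z, norm_mul, norm_pow]
      exact le_mul_of_one_le_left (norm_nonneg _) (one_le_pow₀ hz)
    intro z
    rcases le_total 1 ‖z‖ with hz | hz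
    · exact (hout z hz).trans (Real.exp_le_exp.2 (by nlinarith))
    · have h1 : ‖G z‖ ≤ Real.exp (2 * A) := by
        refine Complex.norm_le_of_forall_mem_frontier_norm_le (U := Metric.ball 0 1)
          Metric.isBounded_ball hG.diffContOnCl (fun w hw => ?_) ?_
        · rw [frontier_ball _ one_ne_zero, mem_sphere_zero_iff_norm] at hw
          refine (hout w hw.ge).trans_eq ?_
          rw [hw]; ring_nf
        · rw [closure_ball _ one_ne_zero]
          exact mem_closedBall_zero_iff.2 hz
      exact h1.trans (Real.exp_le_exp.2 (by nlinarith [norm_nonneg z]))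
  obtain ⟨r₀, hr₀, hr₀G⟩ : ∃ r₀ : ℝ, 0 < r₀ ∧ ∀ s, G s = 0 → r₀ ≤ ‖s‖ := by
    obtain ⟨ε, hε, hball⟩ := Metric.eventually_nhds_iff.1
      (hG.continuous.continuousAt.eventually_ne hG0)
    refine ⟨ε, hε, fun s hs => ?_⟩
    by_contra! hlt
    exact hball (by simpa using hlt) hs
  -- an integral exponent turns the correction term into a polynomial in `y`
  set N : ℕ := ⌈C⌉₊ with hN
  have hupper : ∀ y : ℝ, 0 < y → ‖G (Complex.I * y) * G (-(Complex.I * y))‖ ≤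
      ‖G 0‖ ^ 2 * (Real.exp (Real.pi * c * y) * (1 + y ^ 2 / r₀ ^ 2) ^ N) := by
    intro y hy
    have := norm_mul_neg_le_of_count_le hG hG0 (c := c) (C := N) (by positivity) hGA hc hr₀ hr₀G
      (fun t ht => by
        refine le_trans (le_of_eq ?_) ((hcount t ht).trans
          (add_le_add le_rfl (Nat.le_ceil C)))
        congr 1
        exact finsum_mem_congr rfl fun s hs => (hord s hs.1).symm) hy
    rwa [Real.exp_add, Real.exp_nat_mul, Real.exp_log (by positivity)] at this
  by_contra! hlt
  set b := 2 * l - Real.pi * c with hb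
  have hb0 : 0 < b := by linarith
  have hlim := Polynomial.tendsto_exp_neg_mul_norm_eval
    (Polynomial.X ^ (2 * m) * (1 - Polynomial.C ((r₀ : ℂ)⁻¹ ^ 2) * Polynomial.X ^ 2) ^ N) hb0
    Complex.norm_I
  have hlim2 := hlim.mul_const (‖G 0‖ ^ 2)
  rw [zero_mul] at hlim2
  obtain ⟨y, ⟨⟨h1, h2⟩, h3⟩, hy⟩ := (((hlow₁.and hlow₂).and
    (hlim2.eventually_lt_const (show 0 < δ₁ * δ₂ by positivity))).and
    (Filter.eventually_gt_atTop 0)).exists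
  have heval : ‖(Polynomial.X ^ (2 * m) * (1 - Polynomial.C ((r₀ : ℂ)⁻¹ ^ 2) *
      Polynomial.X ^ 2) ^ N : Polynomial ℂ).eval (Complex.I * y)‖ =
      y ^ (2 * m) * (1 + y ^ 2 / r₀ ^ 2) ^ N := by
    simp only [Polynomial.eval_mul, Polynomial.eval_pow, Polynomial.eval_X, Polynomial.eval_sub,
      Polynomial.eval_one, Polynomial.eval_C, norm_mul, norm_pow, Complex.norm_I, one_mul,
      Complex.norm_real, Real.norm_eq_abs, abs_of_pos hy]
    congr 2
    have : (1 - (r₀ : ℂ)⁻¹ ^ 2 * (Complex.I * y) ^ 2) = ((1 + y ^ 2 / r₀ ^ 2 : ℝ) : ℂ) := by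
      push_cast
      rw [mul_pow, Complex.I_sq]
      ring
    rw [this, Complex.norm_real, Real.norm_eq_abs, abs_of_pos (by positivity)]
  rw [heval] at h3
  have hprod : ‖F (Complex.I * y)‖ * ‖F (-(Complex.I * y))‖ =
      y ^ (2 * m) * ‖G (Complex.I * y) * G (-(Complex.I * y))‖ := by
    rw [hFG, hFG (-(Complex.I * y))]
    simp only [norm_mul, norm_pow, norm_neg, Complex.norm_I, Complex.norm_real, Real.norm_eq_abs,
      abs_of_pos hy]
    ring
  have hchain : δ₁ * δ₂ * Real.exp (2 * l * y) ≤ Real.exp (Real.pi * c * y) *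
      (y ^ (2 * m) * (1 + y ^ 2 / r₀ ^ 2) ^ N * ‖G 0‖ ^ 2) := by
    calc δ₁ * δ₂ * Real.exp (2 * l * y) =
        (δ₁ * Real.exp (l * y)) * (δ₂ * Real.exp (l * y)) := by
          rw [show 2 * l * y = l * y + l * y by ring, Real.exp_add]; ring
      _ ≤ ‖F (Complex.I * y)‖ * ‖F (-(Complex.I * y))‖ := by gcongr
      _ ≤ y ^ (2 * m) *
          (‖G 0‖ ^ 2 * (Real.exp (Real.pi * c * y) * (1 + y ^ 2 / r₀ ^ 2) ^ N)) := by
          rw [hprod]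
          gcongr
          exact hupper y hy
      _ = _ := by ring
  have hexp : Real.exp (2 * l * y) = Real.exp (Real.pi * c * y) * Real.exp (b * y) := by
    rw [← Real.exp_add, hb]; ring_nf
  rw [hexp, mul_left_comm] at hchain
  have h4 := le_of_mul_le_mul_left hchain (Real.exp_pos _)
  rw [Real.exp_neg, mul_assoc, inv_mul_lt_iff₀ (Real.exp_pos _)] at h3
  linarith

/-! ### The determinant of the coupling system -/

section Columns

variable {R n : Type*} [CommRing R] [DecidableEq n]

/-- The `j`-th column of `(1 - κ) U - (1 + κ) I`. With `κ = k` it is the contribution of a wave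
`exp (ikx)` leaving the vertex through the `j`-th end, with `κ = -k` that of the incoming wave. -/
def couplingColumn (U : Matrix n n R) (κ : R) (j : n) (i : n) : R :=
  (1 - κ) * U i j - (1 + κ) * (1 : Matrix n n R) i j

/-- The determinant of the matrix whose two internal columns are `v` and `w` and whose lead columns
are those of `(1 - κ) U - (1 + κ) I`. -/
def endDet {M : ℕ} (U : Matrix (Fin 2 ⊕ Fin M) (Fin 2 ⊕ Fin M) R) (κ : R)
    (v w : Fin 2 ⊕ Fin M → R) : R :=
  (Matrix.of fun i j => Sum.elim ![v i, w i] (fun m => couplingColumn U κ (Sum.inr m) i) j).det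

variable {M : ℕ} (U : Matrix (Fin 2 ⊕ Fin M) (Fin 2 ⊕ Fin M) R) (κ : R)

theorem endDet_add_smul_left (v v' w : Fin 2 ⊕ Fin M → R) (a : R) :
    endDet U κ (v + a • v') w = endDet U κ v w + a * endDet U κ v' w := by
  have h : ∀ u : Fin 2 ⊕ Fin M → R, endDet U κ u w = ((Matrix.of fun i j =>
      Sum.elim ![v i, w i] (fun m => couplingColumn U κ (Sum.inr m) i) j).updateCol
        (Sum.inl 0) u).det := by
    intro u
    unfold endDet
    congr 1
    ext i j
    rcases j with j | j
    · fin_cases j <;> simp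
    · simp
  rw [h, h, h, Matrix.det_updateCol_add, Matrix.det_updateCol_smul]

theorem endDet_add_smul_right (v w w' : Fin 2 ⊕ Fin M → R) (a : R) :
    endDet U κ v (w + a • w') = endDet U κ v w + a * endDet U κ v w' := by
  have h : ∀ u : Fin 2 ⊕ Fin M → R, endDet U κ v u = ((Matrix.of fun i j =>
      Sum.elim ![v i, w i] (fun m => couplingColumn U κ (Sum.inr m) i) j).updateCol
        (Sum.inl 1) u).det := by
    intro u
    unfold endDet
    congr 1
    ext i j
    rcases j with j | j
    · fin_cases j <;> simp
    · simp
  rw [h, h, h, Matrix.det_updateCol_add, Matrix.det_updateCol_smul]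

theorem map_endDet {S : Type*} [CommRing S] (φ : R →+* S) (v w : Fin 2 ⊕ Fin M → R) :
    φ (endDet U κ v w) = endDet (U.map φ) (φ κ) (φ ∘ v) (φ ∘ w) := by
  unfold endDet
  rw [RingHom.map_det]
  congr 1
  ext i j
  rcases j with j | j
  · fin_cases j <;> simp
  · simp [couplingColumn, Matrix.one_apply, apply_ite φ]

theorem map_couplingColumn {S : Type*} [CommRing S] (φ : R →+* S) (U : Matrix n n R) (κ : R)
    (j : n) : φ ∘ couplingColumn U κ j = couplingColumn (U.map φ) (φ κ) j := by
  ext i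
  simp [couplingColumn, Matrix.one_apply, apply_ite φ]

/-- The effective coupling matrix `U₁ - (1 - κ) U₂ [(1 - κ) U₄ - (κ + 1) I]⁻¹ U₃` of an arbitrary
coupling matrix; without a magnetic field it is the one of the graph. The inverse has its junk
value `0` if the matrix is singular. -/
noncomputable def schurCoupling : Matrix (Fin 2) (Fin 2) R :=
  U.toBlocks₁₁ - (1 - κ) •
    (U.toBlocks₁₂ * ((1 - κ) • U.toBlocks₂₂ - (κ + 1) • (1 : Matrix (Fin M) (Fin M) R))⁻¹ *
      U.toBlocks₂₁)

/-- Eliminating the leads by a Schur complement replaces `U` by its effective coupling matrix. -/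
theorem endDet_couplingColumn_eq
    (hL : IsUnit ((1 - κ) • U.toBlocks₂₂ - (κ + 1) • (1 : Matrix (Fin M) (Fin M) R)))
    (κ₁ κ₂ : R) (a b : Fin 2) :
    endDet U κ (couplingColumn U κ₁ (Sum.inl a)) (couplingColumn U κ₂ (Sum.inl b)) =
      ((1 - κ) • U.toBlocks₂₂ - (κ + 1) • (1 : Matrix (Fin M) (Fin M) R)).det *
      (couplingColumn (schurCoupling U κ) κ₁ a 0 * couplingColumn (schurCoupling U κ) κ₂ b 1 -
        couplingColumn (schurCoupling U κ) κ₂ b 0 *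
          couplingColumn (schurCoupling U κ) κ₁ a 1) := by
  set L := (1 - κ) • U.toBlocks₂₂ - (κ + 1) • (1 : Matrix (Fin M) (Fin M) R) with hLdef
  let _ : Invertible L := hL.invertible
  set A : Matrix (Fin 2) (Fin 2) R := Matrix.of fun i j =>
    ![couplingColumn U κ₁ (Sum.inl a) (Sum.inl i), couplingColumn U κ₂ (Sum.inl b) (Sum.inl i)] j
    with hA
  -- `D` holds the coefficients with which the internal columns enter the lead rows
  set D : Matrix (Fin 2) (Fin 2) R := Matrix.of fun i j =>
    (![Pi.single a (1 - κ₁), Pi.single b (1 - κ₂)] : Fin 2 → Fin 2 → R) j i with hD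
  have hblocks : endDet U κ (couplingColumn U κ₁ (Sum.inl a)) (couplingColumn U κ₂ (Sum.inl b)) =
      (Matrix.fromBlocks A ((1 - κ) • U.toBlocks₁₂) (U.toBlocks₂₁ * D) L).det := by
    unfold endDet
    congr 1
    ext i j
    rcases i with i | i <;> rcases j with j | j
    · fin_cases j <;> simp [hA]
    · simp [couplingColumn, Matrix.toBlocks₁₂]
    · fin_cases j <;> simp [couplingColumn, Matrix.mul_apply, hD, Pi.single_apply,
        Matrix.toBlocks₂₁, mul_comm]
    · simp [hLdef, couplingColumn, Matrix.toBlocks₂₂, Matrix.one_apply, add_comm]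
  have hT : A - (1 - κ) • U.toBlocks₁₂ * ⅟L * (U.toBlocks₂₁ * D) = Matrix.of fun i j =>
      ![couplingColumn (schurCoupling U κ) κ₁ a i,
        couplingColumn (schurCoupling U κ) κ₂ b i] j := by
    have h1 : schurCoupling U κ * D = U.toBlocks₁₁ * D -
        (1 - κ) • U.toBlocks₁₂ * ⅟L * (U.toBlocks₂₁ * D) := by
      rw [schurCoupling, ← hLdef, Matrix.sub_mul, ← Matrix.invOf_eq_nonsing_inv]
      simp only [Matrix.smul_mul, Matrix.mul_assoc]
    have h2 : A - (1 - κ) • U.toBlocks₁₂ * ⅟L * (U.toBlocks₂₁ * D) =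
        A - U.toBlocks₁₁ * D + schurCoupling U κ * D := by rw [h1]; abel
    rw [h2]
    ext i j
    fin_cases j <;> simp [hA, hD, Matrix.mul_apply, couplingColumn, Pi.single_apply,
      Matrix.toBlocks₁₁, Matrix.one_apply] <;> ring
  rw [hblocks, Matrix.det_fromBlocks₂₂, hT, Matrix.det_fin_two]
  simp

end Columns

/-- The determinant `endDet`, as a polynomial in `k`, with internal columns the `a`-th column for
the parameter `s` and the `b`-th column for the parameter `t`; in use are `s, t = ± X`. -/
noncomputable def endPoly {M : ℕ} (U : Matrix (Fin 2 ⊕ Fin M) (Fin 2 ⊕ Fin M) ℂ)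
    (s : Polynomial ℂ) (a : Fin 2) (t : Polynomial ℂ) (b : Fin 2) : Polynomial ℂ :=
  endDet (U.map Polynomial.C) Polynomial.X (couplingColumn (U.map Polynomial.C) s (Sum.inl a))
    (couplingColumn (U.map Polynomial.C) t (Sum.inl b))

theorem eval_endPoly {M : ℕ} (U : Matrix (Fin 2 ⊕ Fin M) (Fin 2 ⊕ Fin M) ℂ)
    (s : Polynomial ℂ) (a : Fin 2) (t : Polynomial ℂ) (b : Fin 2) (k : ℂ) :
    (endPoly U s a t b).eval k = endDet U k (couplingColumn U (s.eval k) (Sum.inl a))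
      (couplingColumn U (t.eval k) (Sum.inl b)) := by
  have h : (U.map Polynomial.C).map (Polynomial.evalRingHom k) = U := by ext; simp
  have := map_endDet (U.map Polynomial.C) Polynomial.X (Polynomial.evalRingHom k)
    (couplingColumn (U.map Polynomial.C) s (Sum.inl a))
    (couplingColumn (U.map Polynomial.C) t (Sum.inl b))
  rw [map_couplingColumn, map_couplingColumn, h] at this
  simpa [endPoly] using this

theorem finite_not_isUnit_lead {M : ℕ} (B : Matrix (Fin M) (Fin M) ℂ) :
    {k : ℂ | ¬ IsUnit ((1 - k) • B - (k + 1) • (1 : Matrix (Fin M) (Fin M) ℂ))}.Finite := by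
  set P : Polynomial ℂ := ((1 - Polynomial.X : Polynomial ℂ) • B.map Polynomial.C -
    (Polynomial.X + 1 : Polynomial ℂ) • (1 : Matrix (Fin M) (Fin M) (Polynomial ℂ))).det with hP
  have heval : ∀ k, P.eval k = ((1 - k) • B - (k + 1) • (1 : Matrix (Fin M) (Fin M) ℂ)).det := by
    intro k
    rw [hP, ← Polynomial.coe_evalRingHom, RingHom.map_det]
    congr 1
    ext i j
    rcases eq_or_ne i j with rfl | hij <;> simp [*]
  have hP0 : P ≠ 0 := by
    intro h
    -- at `k = 1` the matrix is `-2 I`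
    have := heval 1
    rw [h, sub_self, zero_smul, zero_sub, Polynomial.eval_zero, ← neg_smul, Matrix.det_smul] at this
    rw [Matrix.det_one, mul_one] at this
    exact pow_ne_zero _ (by norm_num) this.symm
  refine (P.rootSet_finite ℂ).subset fun k hk => ?_
  rw [Polynomial.mem_rootSet]
  refine ⟨hP0, ?_⟩
  rw [Polynomial.coe_aeval_eq_eval, heval]
  by_contra hne
  exact hk ((Matrix.isUnit_iff_isUnit_det _).2 (isUnit_iff_ne_zero.2 hne))

theorem exists_coprime_factors (α β : Polynomial ℂ) :
    ∃ g p q : Polynomial ℂ, α = g * p ∧ β = g * q ∧ IsCoprime p q := by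
  let _ : GCDMonoid (Polynomial ℂ) := UniqueFactorizationMonoid.toGCDMonoid _
  obtain ⟨p, q, hp, hq, h⟩ := extract_gcd α β
  exact ⟨gcd α β, p, q, hp, hq, (gcd_isUnit_iff p q).1 h⟩

/-- Polynomials of equal modulus off a finite set are proportional with a unimodular constant, so a
phase `exp (± iφ)` makes them cancel. -/
theorem exists_phase_of_norm_eval_eq {α β : Polynomial ℂ} {S : Set ℂ} (hS : S.Finite)
    (h : ∀ k ∉ S, ‖α.eval k‖ = ‖β.eval k‖) :
    ∃ φ : ℝ, Polynomial.C (Complex.exp (Complex.I * φ)) * α +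
      Polynomial.C (Complex.exp (-(Complex.I * φ))) * β = 0 := by
  have hext : ∀ {p q : Polynomial ℂ} {T : Set ℂ}, T.Finite →
      (∀ k ∉ T, ‖p.eval k‖ = ‖q.eval k‖) → ∀ k, ‖p.eval k‖ = ‖q.eval k‖ :=
    fun {p q _} hT hpq k => congrFun (Continuous.ext_on (hT.countable.dense_compl ℂ)
      p.continuous.norm q.continuous.norm fun k hk => hpq k hk) k
  have heq := hext hS h
  by_cases hβ : β = 0
  · have hα : α = 0 := Polynomial.funext fun k => by
      have := heq k
      simpa [hβ] using this
    exact ⟨0, by simp [hα, hβ]⟩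
  obtain ⟨g, p, q, hα, hβ', hcop⟩ := exists_coprime_factors α β
  have hg0 : g ≠ 0 := fun h => hβ (by rw [hβ', h, zero_mul])
  have hpq : ∀ k, ‖p.eval k‖ = ‖q.eval k‖ := hext (g.rootSet_finite ℂ) fun k hk => by
    have hgk : g.eval k ≠ 0 := by
      simpa [Polynomial.mem_rootSet, hg0, Polynomial.coe_aeval_eq_eval] using hk
    have := heq k
    rw [hα, hβ', Polynomial.eval_mul, Polynomial.eval_mul, norm_mul, norm_mul] at this
    exact mul_left_cancel₀ (norm_ne_zero_iff.2 hgk) this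
  -- a common root of the coprime factors is impossible, so both are constant
  have hroot : ∀ k, ¬ (p.eval k = 0 ∧ q.eval k = 0) := by
    rintro k ⟨hp, hq⟩
    obtain ⟨u, v, huv⟩ := hcop
    have := congrArg (Polynomial.eval k) huv
    simp [hp, hq] at this
  have hdeg : ∀ f : Polynomial ℂ, (∀ k, f.eval k ≠ 0) → ∃ c, f = Polynomial.C c := by
    intro f hf
    refine ⟨_, Polynomial.eq_C_of_degree_eq_zero ?_⟩
    by_contra hne
    obtain ⟨k, hk⟩ := IsAlgClosed.exists_root f hne
    exact hf k hk
  obtain ⟨x, rfl⟩ := hdeg p fun k hk => hroot k ⟨hk, by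
    rw [← norm_eq_zero, ← hpq, hk, norm_zero]⟩
  obtain ⟨y, rfl⟩ := hdeg q fun k hk => hroot k ⟨by
    rw [← norm_eq_zero, hpq, hk, norm_zero], hk⟩
  have hxy : ‖x‖ = ‖y‖ := by simpa using hpq 0
  have hx : x ≠ 0 := by
    rintro rfl
    exact hroot 0 ⟨by simp, by simpa using hxy.symm⟩
  have hunit : ‖-y / x‖ = 1 := by
    rw [norm_div, norm_neg, hxy, div_self]
    rwa [← hxy, norm_ne_zero_iff]
  refine ⟨Complex.arg (-y / x) / 2, ?_⟩
  set e := Complex.exp (Complex.I * ((Complex.arg (-y / x) / 2 : ℝ) : ℂ)) with he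
  have he2 : e * e = -y / x := by
    rw [he, ← Complex.exp_add]
    have h1 := Complex.norm_mul_exp_arg_mul_I (-y / x)
    rw [hunit, Complex.ofReal_one, one_mul] at h1
    rw [← h1]
    congr 1
    rw [h1]
    push_cast
    ring
  have he0 : e ≠ 0 := Complex.exp_ne_zero _
  rw [Complex.exp_neg, ← he, hα, hβ']
  have h3 : e * x + e⁻¹ * y = 0 := by
    field_simp at he2 ⊢
    linear_combination he2
  calc _ = g * Polynomial.C (e * x + e⁻¹ * y) := by
        simp only [Polynomial.C_add, Polynomial.C_mul]; ring
    _ = 0 := by rw [h3, Polynomial.C_0, mul_zero]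

/-- The two determinants are `-4k ũ₂₁` and `-4k ũ₁₂` times the determinant of the lead matrix. -/
theorem norm_eval_endPoly_eq {M : ℕ} (U : Matrix (Fin 2 ⊕ Fin M) (Fin 2 ⊕ Fin M) ℂ) {k : ℂ}
    (hL : IsUnit ((1 - k) • U.toBlocks₂₂ - (k + 1) • (1 : Matrix (Fin M) (Fin M) ℂ)))
    (h : ‖schurCoupling U k 0 1‖ = ‖schurCoupling U k 1 0‖) :
    ‖(endPoly U Polynomial.X 0 (-Polynomial.X) 0).eval k‖ =
      ‖(endPoly U (-Polynomial.X) 1 Polynomial.X 1).eval k‖ := by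
  rw [eval_endPoly, eval_endPoly, endDet_couplingColumn_eq U k hL,
    endDet_couplingColumn_eq U k hL]
  simp only [couplingColumn, Polynomial.eval_neg, Polynomial.eval_X, Matrix.one_apply]
  set T := schurCoupling U k
  have h1 : ∀ d : ℂ, d * (((1 - k) * T 0 0 - (1 + k) * 1) * ((1 - -k) * T 1 0 - (1 + -k) * 0) -
      ((1 - -k) * T 0 0 - (1 + -k) * 1) * ((1 - k) * T 1 0 - (1 + k) * 0)) =
      (d * (-4 * k)) * T 1 0 := fun d => by ring
  have h2 : ∀ d : ℂ, d * (((1 - -k) * T 0 1 - (1 + -k) * 0) * ((1 - k) * T 1 1 - (1 + k) * 1) -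
      ((1 - k) * T 0 1 - (1 + k) * 0) * ((1 - -k) * T 1 1 - (1 + -k) * 1)) =
      (d * (-4 * k)) * T 0 1 := fun d => by ring
  simp only [if_true, zero_ne_one, one_ne_zero, if_false]
  rw [h1, h2, norm_mul, norm_mul _ (T 0 1), h]

/-! ### Solutions on the edge and the characteristic determinant -/

namespace OneEdgeQuantumGraph

variable {M : ℕ}

/-- The gauge factor `exp (-i ∫₀ˣ A)`, which removes the potential from the internal edge. -/
noncomputable def gaugePhase (Γ : OneEdgeQuantumGraph M) (x : ℝ) : ℂ :=
  Complex.exp (-Complex.I * ((∫ t in (0 : ℝ)..x, Γ.potential t : ℝ) : ℂ))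

/-- The solution `exp (-i ∫₀ˣ A) (a exp (ikx) + b exp (-ikx))` on the internal edge. -/
noncomputable def edgeWave (Γ : OneEdgeQuantumGraph M) (k a b : ℂ) (x : ℝ) : ℂ :=
  Γ.gaugePhase x * (a * Complex.exp (Complex.I * k * x) + b * Complex.exp (-(Complex.I * k * x)))

theorem gaugePhase_ne_zero (Γ : OneEdgeQuantumGraph M) (x : ℝ) : Γ.gaugePhase x ≠ 0 :=
  Complex.exp_ne_zero _

theorem gaugePhase_zero (Γ : OneEdgeQuantumGraph M) : Γ.gaugePhase 0 = 1 := by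
  simp [gaugePhase]

theorem gaugePhase_length (Γ : OneEdgeQuantumGraph M) :
    Γ.gaugePhase Γ.length = Complex.exp (-(Complex.I * Γ.flux)) := by
  simp [gaugePhase, flux]

theorem uniqueDiffOn_edge (Γ : OneEdgeQuantumGraph M) :
    UniqueDiffOn ℝ (Set.Icc 0 Γ.length) := uniqueDiffOn_Icc Γ.length_pos

theorem hasDerivWithinAt_integral_potential (Γ : OneEdgeQuantumGraph M) {x : ℝ}
    (hx : x ∈ Set.Icc 0 Γ.length) :
    HasDerivWithinAt (fun x => ∫ t in (0 : ℝ)..x, Γ.potential t) (Γ.potential x)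
      (Set.Icc 0 Γ.length) x := by
  have hc := Γ.potential_contDiffOn.continuousOn
  have : Fact (x ∈ Set.Icc 0 Γ.length) := ⟨hx⟩
  refine intervalIntegral.integral_hasDerivWithinAt_right ?_
    (hc.stronglyMeasurableAtFilter_nhdsWithin measurableSet_Icc x) (hc x hx)
  refine (hc.mono ?_).intervalIntegrable
  rw [Set.uIcc_of_le hx.1]
  exact Set.Icc_subset_Icc_right hx.2

theorem hasDerivWithinAt_gaugePhase (Γ : OneEdgeQuantumGraph M) {x : ℝ}
    (hx : x ∈ Set.Icc 0 Γ.length) :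
    HasDerivWithinAt Γ.gaugePhase (-Complex.I * Γ.potential x * Γ.gaugePhase x)
      (Set.Icc 0 Γ.length) x := by
  have := ((Γ.hasDerivWithinAt_integral_potential hx).ofReal_comp.const_mul (-Complex.I)).cexp
  refine this.congr_deriv ?_
  simp only [gaugePhase]
  ring

theorem contDiffOn_gaugePhase (Γ : OneEdgeQuantumGraph M) :
    ContDiffOn ℝ 2 Γ.gaugePhase (Set.Icc 0 Γ.length) := by
  have h : ContDiffOn ℝ (1 + 1) (fun x => ∫ t in (0 : ℝ)..x, Γ.potential t)
      (Set.Icc 0 Γ.length) := by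
    rw [contDiffOn_succ_iff_derivWithin Γ.uniqueDiffOn_edge]
    refine ⟨fun x hx => (Γ.hasDerivWithinAt_integral_potential hx).differentiableWithinAt,
      by simp, Γ.potential_contDiffOn.congr fun x hx =>
      (Γ.hasDerivWithinAt_integral_potential hx).derivWithin (Γ.uniqueDiffOn_edge x hx)⟩
  have h2 : ContDiffOn ℝ 2 (fun x => ((∫ t in (0 : ℝ)..x, Γ.potential t : ℝ) : ℂ))
      (Set.Icc 0 Γ.length) := Complex.ofRealCLM.contDiff.comp_contDiffOn h
  exact (contDiffOn_const.mul h2).cexp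

theorem contDiffOn_edgeWave (Γ : OneEdgeQuantumGraph M) (k a b : ℂ) :
    ContDiffOn ℝ 2 (Γ.edgeWave k a b) (Set.Icc 0 Γ.length) := by
  have h : ContDiff ℝ 2 (fun x : ℝ => a * Complex.exp (Complex.I * k * x) +
      b * Complex.exp (-(Complex.I * k * x))) := by
    have := Complex.ofRealCLM.contDiff (n := 2)
    have h1 : ContDiff ℝ 2 (fun x : ℝ => (x : ℂ)) := this
    fun_prop
  exact Γ.contDiffOn_gaugePhase.mul h.contDiffOn

theorem hasDerivWithinAt_edgeWave (Γ : OneEdgeQuantumGraph M) (k a b : ℂ) {x : ℝ}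
    (hx : x ∈ Set.Icc 0 Γ.length) :
    HasDerivWithinAt (Γ.edgeWave k a b)
      (Γ.edgeWave k (Complex.I * k * a) (-(Complex.I * k * b)) x -
        Complex.I * Γ.potential x * Γ.edgeWave k a b x) (Set.Icc 0 Γ.length) x := by
  have hlin : HasDerivAt (fun x : ℝ => Complex.I * k * (x : ℂ)) (Complex.I * k) x := by
    simpa using (Complex.ofRealCLM.hasDerivAt (x := x)).const_mul (Complex.I * k)
  have h1 := (hlin.cexp.const_mul a).add (hlin.neg.cexp.const_mul b)
  refine ((Γ.hasDerivWithinAt_gaugePhase hx).mul h1.hasDerivWithinAt).congr_deriv ?_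
  simp only [edgeWave, Pi.add_apply, Pi.neg_apply]
  ring

/-- The hypothesis is equality on the edge only, so that the lemma can be applied twice: the
magnetic derivative of a wave agrees with a wave on the edge but not beyond it. -/
theorem magDeriv_of_eqOn_edgeWave (Γ : OneEdgeQuantumGraph M) {k a b : ℂ} {f : ℝ → ℂ}
    (hf : Set.EqOn f (Γ.edgeWave k a b) (Set.Icc 0 Γ.length)) :
    Set.EqOn (Γ.magDeriv f) (Γ.edgeWave k (Complex.I * k * a) (-(Complex.I * k * b)))
      (Set.Icc 0 Γ.length) := by
  intro x hx
  rw [magDeriv, derivWithin_congr hf (hf hx),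
    (Γ.hasDerivWithinAt_edgeWave k a b hx).derivWithin (Γ.uniqueDiffOn_edge x hx), hf hx]
  ring

theorem neg_magDeriv_magDeriv_edgeWave (Γ : OneEdgeQuantumGraph M) (k a b : ℂ) {x : ℝ}
    (hx : x ∈ Set.Icc 0 Γ.length) :
    -Γ.magDeriv (Γ.magDeriv (Γ.edgeWave k a b)) x = k ^ 2 * Γ.edgeWave k a b x := by
  rw [Γ.magDeriv_of_eqOn_edgeWave (Γ.magDeriv_of_eqOn_edgeWave (Set.eqOn_refl _ _)) hx]
  simp only [edgeWave]
  linear_combination (-(k ^ 2 * Γ.gaugePhase x * (a * Complex.exp (Complex.I * k * x) +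
    b * Complex.exp (-(Complex.I * k * x))))) * Complex.I_sq

/-- For `κ = ± k` the function `exp (i ∫₀ˣ A) (D f - iκ f) exp (iκx)`, with `D` the magnetic
derivative, is constant on the edge; the two constants determine `f`. -/
theorem exists_eqOn_edgeWave (Γ : OneEdgeQuantumGraph M) {k : ℂ} (hk : k ≠ 0) {f : ℝ → ℂ}
    (hf : ContDiffOn ℝ 2 f (Set.Icc 0 Γ.length))
    (hode : ∀ x ∈ Set.Icc 0 Γ.length, -Γ.magDeriv (Γ.magDeriv f) x = k ^ 2 * f x) :
    ∃ a b, Set.EqOn f (Γ.edgeWave k a b) (Set.Icc 0 Γ.length) := by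
  set J := Set.Icc 0 Γ.length with hJ
  have hu := Γ.uniqueDiffOn_edge
  have hfd : ∀ x ∈ J,
      HasDerivWithinAt f (Γ.magDeriv f x - Complex.I * Γ.potential x * f x) J x := by
    intro x hx
    refine ((hf.differentiableOn (by norm_num)) x hx).hasDerivWithinAt.congr_deriv ?_
    rw [magDeriv]; ring
  have hDd : DifferentiableOn ℝ (Γ.magDeriv f) J := by
    have h1 : DifferentiableOn ℝ (derivWithin f J) J :=
      (hf.derivWithin hu (m := 1) (by norm_num)).differentiableOn (by norm_num)
    have h2 : DifferentiableOn ℝ (fun x => (Γ.potential x : ℂ)) J :=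
      Complex.ofRealCLM.differentiable.comp_differentiableOn
        (Γ.potential_contDiffOn.differentiableOn (by norm_num))
    exact h1.add ((h2.const_mul Complex.I).mul (hf.differentiableOn (by norm_num)))
  have hD : ∀ x ∈ J, HasDerivWithinAt (Γ.magDeriv f)
      (-(k ^ 2 * f x) - Complex.I * Γ.potential x * Γ.magDeriv f x) J x := by
    intro x hx
    refine (hDd x hx).hasDerivWithinAt.congr_deriv ?_
    rw [← hode x hx, neg_neg]
    conv_rhs => rw [magDeriv]
    ring
  have hconst : ∀ κ : ℂ, κ ^ 2 = k ^ 2 → ∀ x ∈ J,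
      (Γ.gaugePhase x)⁻¹ * (Γ.magDeriv f x - Complex.I * κ * f x) *
        Complex.exp (Complex.I * κ * x) = Γ.magDeriv f 0 - Complex.I * κ * f 0 := by
    intro κ hκ
    have hd : ∀ x ∈ J, HasDerivWithinAt (fun x : ℝ => (Γ.gaugePhase x)⁻¹ *
        (Γ.magDeriv f x - Complex.I * κ * f x) * Complex.exp (Complex.I * κ * x)) 0 J x := by
      intro x hx
      have hlin : HasDerivAt (fun x : ℝ => Complex.I * κ * (x : ℂ)) (Complex.I * κ) x := by
        simpa using (Complex.ofRealCLM.hasDerivAt (x := x)).const_mul (Complex.I * κ)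
      have h1 := (((Γ.hasDerivWithinAt_gaugePhase hx).fun_inv (Γ.gaugePhase_ne_zero x)).mul
        ((hD x hx).sub ((hfd x hx).const_mul (Complex.I * κ)))).mul hlin.cexp.hasDerivWithinAt
      refine h1.congr_deriv ?_
      have := Γ.gaugePhase_ne_zero x
      simp only [Pi.sub_apply, Pi.mul_apply]
      field_simp
      rw [← hκ]
      linear_combination (-(Complex.exp (Complex.I * κ * x) * κ ^ 2 * f x)) * Complex.I_sq
    intro x hx
    have := constant_of_derivWithin_zero (fun x hx => (hd x hx).differentiableWithinAt)
      (fun x hx => (hd x (Set.Ico_subset_Icc_self hx)).derivWithin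
        (hu x (Set.Ico_subset_Icc_self hx))) x hx
    simpa [gaugePhase_zero] using this
  set c₁ := Γ.magDeriv f 0 - Complex.I * k * f 0
  set c₂ := Γ.magDeriv f 0 - Complex.I * (-k) * f 0
  refine ⟨c₂ / (2 * Complex.I * k), -c₁ / (2 * Complex.I * k), fun x hx => ?_⟩
  have h1 : _ = c₁ := hconst k rfl x hx
  have h2 : _ = c₂ := hconst (-k) (by ring) x hx
  rw [edgeWave, ← h1, ← h2]
  have hI := Complex.I_ne_zero
  have hp := Γ.gaugePhase_ne_zero x
  have he := Complex.exp_ne_zero (Complex.I * k * x)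
  rw [show Complex.I * -k * (x : ℂ) = -(Complex.I * k * x) by ring, Complex.exp_neg]
  field_simp
  ring

/-- The column of the coupling system that belongs to `exp (-i ∫₀ˣ A) exp (ikx)`: this wave leaves
the vertex at the start of the edge and arrives at its end. -/
noncomputable def outgoingColumn (Γ : OneEdgeQuantumGraph M) (k : ℂ) : Fin 2 ⊕ Fin M → ℂ :=
  couplingColumn Γ.coupling k (Sum.inl 0) +
    (Complex.exp (-(Complex.I * Γ.flux)) * Complex.exp (Complex.I * k * Γ.length)) •
      couplingColumn Γ.coupling (-k) (Sum.inl 1)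

/-- The column of the coupling system that belongs to `exp (-i ∫₀ˣ A) exp (-ikx)`: this wave
arrives at the vertex at the start of the edge and leaves it at its end. -/
noncomputable def incomingColumn (Γ : OneEdgeQuantumGraph M) (k : ℂ) : Fin 2 ⊕ Fin M → ℂ :=
  couplingColumn Γ.coupling (-k) (Sum.inl 0) +
    (Complex.exp (-(Complex.I * Γ.flux)) * Complex.exp (-(Complex.I * k * Γ.length))) •
      couplingColumn Γ.coupling k (Sum.inl 1)

theorem couplingForm_apply (Γ : OneEdgeQuantumGraph M) (f : ℝ → ℂ) (g : Fin M → ℝ → ℂ)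
    (i : Fin 2 ⊕ Fin M) :
    Γ.couplingForm f g i =
      Γ.coupling i (Sum.inl 0) * (f 0 + Complex.I * Γ.magDeriv f 0) +
      Γ.coupling i (Sum.inl 1) * (f Γ.length - Complex.I * Γ.magDeriv f Γ.length) +
      ∑ m, Γ.coupling i (Sum.inr m) * (g m 0 + Complex.I * derivWithin (g m) (Set.Ici 0) 0) -
      Sum.elim ![f 0 - Complex.I * Γ.magDeriv f 0, f Γ.length + Complex.I * Γ.magDeriv f Γ.length]
        (fun m => g m 0 - Complex.I * derivWithin (g m) (Set.Ici 0) 0) i := by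
  have hv : Γ.boundaryDeriv f g + Complex.I • (Γ.boundaryPotential *ᵥ Γ.boundaryValue f g) =
      Sum.elim ![Γ.magDeriv f 0, -Γ.magDeriv f Γ.length]
        (fun m => derivWithin (g m) (Set.Ici 0) 0) := by
    ext j
    rcases j with j | j
    · fin_cases j
      · simp [boundaryDeriv, boundaryPotential, boundaryValue, Matrix.mulVec_diagonal, magDeriv]
        ring
      · simp [boundaryDeriv, boundaryPotential, boundaryValue, Matrix.mulVec_diagonal, magDeriv]
        ring
    · simp [boundaryDeriv, boundaryPotential, boundaryValue, Matrix.mulVec_diagonal]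
  rw [couplingForm, hv, Matrix.sub_mulVec, Matrix.add_mulVec, Matrix.one_mulVec, Matrix.one_mulVec]
  simp only [Pi.add_apply, Pi.sub_apply, Pi.smul_apply, smul_eq_mul, Matrix.mulVec, dotProduct,
    Fintype.sum_sum_type, Fin.sum_univ_two, boundaryValue, Sum.elim_inl, Sum.elim_inr]
  have hs : ∑ m, Γ.coupling i (Sum.inr m) * (g m 0 + Complex.I * derivWithin (g m) (Set.Ici 0) 0) =
      ∑ m, Γ.coupling i (Sum.inr m) * g m 0 +
        Complex.I * ∑ m, Γ.coupling i (Sum.inr m) * derivWithin (g m) (Set.Ici 0) 0 := by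
    rw [Finset.mul_sum, ← Finset.sum_add_distrib]
    exact Finset.sum_congr rfl fun m _ => by ring
  rw [hs]
  rcases i with i | i
  · fin_cases i
    · simp; ring
    · simp; ring
  · simp; ring

/-- The coupling form as a linear function of the amplitudes of an outgoing solution. -/
theorem couplingForm_of_eqOn_edgeWave (Γ : OneEdgeQuantumGraph M) {k a b : ℂ} {c : Fin M → ℂ}
    {f : ℝ → ℂ} {g : Fin M → ℝ → ℂ}
    (hf : Set.EqOn f (Γ.edgeWave k a b) (Set.Icc 0 Γ.length))
    (hg : ∀ m, ∀ x : ℝ, 0 ≤ x → g m x = c m * Complex.exp (Complex.I * k * x))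
    (i : Fin 2 ⊕ Fin M) :
    Γ.couplingForm f g i = a * Γ.outgoingColumn k i + b * Γ.incomingColumn k i +
      ∑ m, c m * couplingColumn Γ.coupling k (Sum.inr m) i := by
  have h0 : (0 : ℝ) ∈ Set.Icc 0 Γ.length := Set.left_mem_Icc.2 Γ.length_pos.le
  have hl : Γ.length ∈ Set.Icc 0 Γ.length := Set.right_mem_Icc.2 Γ.length_pos.le
  have hg0 : ∀ m, g m 0 = c m := fun m => by simpa using hg m 0 le_rfl
  have hg1 : ∀ m, derivWithin (g m) (Set.Ici 0) 0 = Complex.I * k * c m := by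
    intro m
    have hlin : HasDerivAt (fun x : ℝ => Complex.I * k * (x : ℂ)) (Complex.I * k) 0 := by
      simpa using (Complex.ofRealCLM.hasDerivAt (x := 0)).const_mul (Complex.I * k)
    have h1 := (hlin.cexp.const_mul (c m)).hasDerivWithinAt (s := Set.Ici 0)
    rw [derivWithin_congr (s := Set.Ici 0) (fun x hx => hg m x hx) (hg m 0 le_rfl),
      h1.derivWithin (uniqueDiffWithinAt_Ici 0)]
    simp
    ring
  have hs : ∑ m, Γ.coupling i (Sum.inr m) *
      (g m 0 + Complex.I * derivWithin (g m) (Set.Ici 0) 0) =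
      ∑ m, c m * couplingColumn Γ.coupling k (Sum.inr m) i +
        Sum.elim (fun _ : Fin 2 => (0 : ℂ)) (fun m => (1 + k) * c m) i := by
    have h1 : ∀ m, Γ.coupling i (Sum.inr m) *
        (g m 0 + Complex.I * derivWithin (g m) (Set.Ici 0) 0) =
        c m * couplingColumn Γ.coupling k (Sum.inr m) i +
          (1 + k) * ((1 : Matrix (Fin 2 ⊕ Fin M) (Fin 2 ⊕ Fin M) ℂ) i (Sum.inr m) * c m) := by
      intro m
      rw [hg0, hg1, couplingColumn]
      linear_combination (Γ.coupling i (Sum.inr m) * k * c m) * Complex.I_sq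
    rw [Finset.sum_congr rfl fun m _ => h1 m, Finset.sum_add_distrib, ← Finset.mul_sum]
    rcases i with i | i <;> simp [Matrix.one_apply]
  rw [couplingForm_apply, hs, Γ.magDeriv_of_eqOn_edgeWave hf h0, Γ.magDeriv_of_eqOn_edgeWave hf hl,
    hf h0, hf hl]
  simp only [edgeWave, gaugePhase_zero, gaugePhase_length, outgoingColumn, incomingColumn,
    Pi.add_apply, Pi.smul_apply, smul_eq_mul]
  generalize Complex.exp (-(Complex.I * Γ.flux)) = ε
  generalize Complex.exp (Complex.I * k * Γ.length) = E
  generalize Complex.exp (-(Complex.I * k * Γ.length)) = E'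
  generalize ∑ m, c m * couplingColumn Γ.coupling k (Sum.inr m) i = σ
  rcases i with i | i
  · obtain rfl | rfl : i = 0 ∨ i = 1 := by fin_cases i <;> simp
    · simp [couplingColumn]
      linear_combination (Γ.coupling (Sum.inl 0) (Sum.inl 0) * k * (a - b) -
        Γ.coupling (Sum.inl 0) (Sum.inl 1) * ε * k * (a * E - b * E') +
        k * (a - b)) * Complex.I_sq
    · simp [couplingColumn]
      linear_combination (Γ.coupling (Sum.inl 1) (Sum.inl 0) * k * (a - b) -
        Γ.coupling (Sum.inl 1) (Sum.inl 1) * ε * k * (a * E - b * E') -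
        k * ε * (a * E - b * E')) * Complex.I_sq
  · simp [couplingColumn, hg0, hg1]
    linear_combination (Γ.coupling (Sum.inr i) (Sum.inl 0) * k * (a - b) -
      Γ.coupling (Sum.inr i) (Sum.inl 1) * ε * k * (a * E - b * E') + k * c i) * Complex.I_sq

theorem charDet_eq_endDet (Γ : OneEdgeQuantumGraph M) (k : ℂ) :
    Γ.charDet k = endDet Γ.coupling k (Γ.outgoingColumn k) (Γ.incomingColumn k) := by
  unfold charDet endDet
  congr 1
  ext i j
  simp only [Matrix.of_apply]
  rcases j with j | j
  · fin_cases j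
    · rw [Γ.couplingForm_of_eqOn_edgeWave (k := k) (a := 1) (b := 0) (c := 0)
        (fun x _ => by simp [edgeSolution, edgeWave, gaugePhase])
        (fun m x _ => by simp [leadSolution])]
      simp
    · rw [Γ.couplingForm_of_eqOn_edgeWave (k := k) (a := 0) (b := 1) (c := 0)
        (fun x _ => by simp [edgeSolution, edgeWave, gaugePhase])
        (fun m x _ => by simp [leadSolution])]
      simp
  · rw [Γ.couplingForm_of_eqOn_edgeWave (k := k) (a := 0) (b := 0) (c := Pi.single j 1)
      (fun x _ => by simp [edgeSolution, edgeWave])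
      (fun m x _ => by simp [leadSolution, Pi.single_apply])]
    simp [Pi.single_apply]

theorem charDet_eq_zero_iff (Γ : OneEdgeQuantumGraph M) (k : ℂ) :
    Γ.charDet k = 0 ↔ ∃ (a b : ℂ) (c : Fin M → ℂ), ¬ (a = 0 ∧ b = 0 ∧ c = 0) ∧
      ∀ i, a * Γ.outgoingColumn k i + b * Γ.incomingColumn k i +
        ∑ m, c m * couplingColumn Γ.coupling k (Sum.inr m) i = 0 := by
  rw [charDet_eq_endDet, endDet, ← Matrix.exists_mulVec_eq_zero_iff]
  have hmul : ∀ (x : Fin 2 ⊕ Fin M → ℂ) i, ((Matrix.of fun i j => Sum.elim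
      ![Γ.outgoingColumn k i, Γ.incomingColumn k i]
      (fun m => couplingColumn Γ.coupling k (Sum.inr m) i) j) *ᵥ x) i =
      x (Sum.inl 0) * Γ.outgoingColumn k i + x (Sum.inl 1) * Γ.incomingColumn k i +
        ∑ m, x (Sum.inr m) * couplingColumn Γ.coupling k (Sum.inr m) i := by
    intro x i
    simp [Matrix.mulVec, dotProduct, mul_comm]
  constructor
  · rintro ⟨x, hx, h⟩
    refine ⟨x (Sum.inl 0), x (Sum.inl 1), fun m => x (Sum.inr m), ?_, fun i => ?_⟩
    · rintro ⟨ha, hb, hc⟩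
      refine hx (funext fun j => ?_)
      rcases j with j | j
      · fin_cases j
        exacts [ha, hb]
      · exact congrFun hc j
    · rw [← hmul, h, Pi.zero_apply]
  · rintro ⟨a, b, c, hne, h⟩
    refine ⟨Sum.elim ![a, b] c, fun h0 => hne ⟨?_, ?_, ?_⟩, funext fun i => ?_⟩
    · simpa using congrFun h0 (Sum.inl 0)
    · simpa using congrFun h0 (Sum.inl 1)
    · exact funext fun m => by simpa using congrFun h0 (Sum.inr m)
    · rw [hmul]
      simpa using h i

/-- The zeros of the characteristic determinant are the resonances; `k = 0` has to be excluded, as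
the waves `exp (± ikx)` coincide there. -/
theorem isResonance_iff (Γ : OneEdgeQuantumGraph M) (k : ℂ) :
    Γ.IsResonance k ↔ k ≠ 0 ∧ Γ.charDet k = 0 := by
  rw [IsResonance, charDet_eq_zero_iff]
  refine and_congr_right fun hk => ⟨?_, ?_⟩
  · rintro ⟨f, g, hf, hode, hg, hform, hne⟩
    obtain ⟨a, b, hab⟩ := Γ.exists_eqOn_edgeWave hk hf hode
    choose c hc using hg
    refine ⟨a, b, c, ?_, fun i => ?_⟩
    · rintro ⟨rfl, rfl, rfl⟩
      rcases hne with ⟨x, hx, hfx⟩ | ⟨m, x, hx, hgx⟩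
      · exact hfx (by simp [hab hx, edgeWave])
      · exact hgx (by simp [hc m x hx])
    · rw [← Γ.couplingForm_of_eqOn_edgeWave hab hc i, hform, Pi.zero_apply]
  · rintro ⟨a, b, c, hne, h⟩
    refine ⟨Γ.edgeWave k a b, fun m x => c m * Complex.exp (Complex.I * k * x),
      Γ.contDiffOn_edgeWave k a b, fun x hx => Γ.neg_magDeriv_magDeriv_edgeWave k a b hx,
      fun m => ⟨c m, fun x _ => rfl⟩, funext fun i => ?_, ?_⟩
    · rw [Γ.couplingForm_of_eqOn_edgeWave (Set.eqOn_refl _ _) (fun m x _ => rfl), h i,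
        Pi.zero_apply]
    · by_contra! hzero
      obtain ⟨hf, hg⟩ := hzero
      have h0 : (0 : ℝ) ∈ Set.Icc 0 Γ.length := Set.left_mem_Icc.2 Γ.length_pos.le
      -- the boundary value and the magnetic derivative at `0` determine `a + b` and `a - b`
      have h1 := hf 0 h0
      have h2 := Γ.magDeriv_of_eqOn_edgeWave (Set.eqOn_refl (Γ.edgeWave k a b) _) h0
      rw [magDeriv, derivWithin_congr (f := fun _ => (0 : ℂ)) hf h1, h1] at h2
      simp only [edgeWave, gaugePhase_zero, derivWithin_fun_const, Pi.zero_apply] at h1 h2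
      simp only [Complex.ofReal_zero, mul_zero, neg_zero, Complex.exp_zero, mul_one, one_mul,
        add_zero] at h1 h2
      have h3 : Complex.I * k ≠ 0 := mul_ne_zero Complex.I_ne_zero hk
      have h4 : a - b = 0 := by
        have : Complex.I * k * (a - b) = 0 := by linear_combination -h2
        exact (mul_eq_zero.1 this).resolve_left h3
      refine hne ⟨by linear_combination (h1 + h4) / 2, by linear_combination (h1 - h4) / 2,
        funext fun m => ?_⟩
      simpa using hg m 0 le_rfl

theorem charDet_eq_expPoly (Γ : OneEdgeQuantumGraph M) (k : ℂ) :
    Γ.charDet k =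
      (endPoly Γ.coupling Polynomial.X 0 (-Polynomial.X) 0).eval k +
      Complex.exp (-(Complex.I * Γ.flux)) ^ 2 *
        (endPoly Γ.coupling (-Polynomial.X) 1 Polynomial.X 1).eval k +
      Complex.exp (-(Complex.I * Γ.flux)) *
        (Complex.exp (Complex.I * k * Γ.length) *
          (endPoly Γ.coupling (-Polynomial.X) 1 (-Polynomial.X) 0).eval k +
        Complex.exp (-(Complex.I * k * Γ.length)) *
          (endPoly Γ.coupling Polynomial.X 0 Polynomial.X 1).eval k) := by
  rw [charDet_eq_endDet, outgoingColumn, incomingColumn, endDet_add_smul_left,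
    endDet_add_smul_right, endDet_add_smul_right]
  simp only [eval_endPoly, Polynomial.eval_X, Polynomial.eval_neg]
  have hE : Complex.exp (Complex.I * k * Γ.length) *
      Complex.exp (-(Complex.I * k * Γ.length)) = 1 := by
    rw [← Complex.exp_add, add_neg_cancel, Complex.exp_zero]
  linear_combination (Complex.exp (-(Complex.I * Γ.flux)) ^ 2 *
    endDet Γ.coupling k (couplingColumn Γ.coupling (-k) (Sum.inl 1))
      (couplingColumn Γ.coupling k (Sum.inl 1))) * hE

end OneEdgeQuantumGraph

/-! ### Nonvanishing, gauge invariance and the effective size -/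

theorem sum_normSq_mulVec_of_mem_unitaryGroup {n : Type*} [Fintype n] [DecidableEq n]
    {U : Matrix n n ℂ} (hU : U ∈ Matrix.unitaryGroup n ℂ) (v : n → ℂ) :
    ∑ i, Complex.normSq ((U *ᵥ v) i) = ∑ i, Complex.normSq (v i) := by
  have h : star (U *ᵥ v) ⬝ᵥ (U *ᵥ v) = star v ⬝ᵥ v := by
    rw [Matrix.star_mulVec, Matrix.dotProduct_mulVec, Matrix.vecMul_vecMul,
      ← Matrix.star_eq_conjTranspose, Matrix.mem_unitaryGroup_iff'.1 hU, Matrix.vecMul_one]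
  have h2 : ∀ w : n → ℂ, star w ⬝ᵥ w = ((∑ i, Complex.normSq (w i) : ℝ) : ℂ) := by
    intro w
    rw [dotProduct, Complex.ofReal_sum]
    exact Finset.sum_congr rfl fun i _ => by
      rw [Complex.normSq_eq_conj_mul_self]; rfl
  rw [h2, h2] at h
  exact_mod_cast h

/-- The difference `|Ψ + iΨ'|² - |Ψ - iΨ'|²` for `Ψ = a + b` and `Ψ' = ik (a - b)`, with
`k = τ (1 + i)`. -/
theorem normSq_sub_normSq_eq (τ : ℝ) (a b : ℂ) :
    Complex.normSq ((1 - τ * (1 + Complex.I)) * a + (1 + τ * (1 + Complex.I)) * b) -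
      Complex.normSq ((1 + τ * (1 + Complex.I)) * a + (1 - τ * (1 + Complex.I)) * b) =
    -4 * τ * (Complex.normSq a - Complex.normSq b) + 8 * τ * (a.im * b.re - a.re * b.im) := by
  simp [Complex.normSq_apply]
  ring

namespace OneEdgeQuantumGraph

variable {M : ℕ}

/-- At `k = (π / l) (1 + i)`, where `exp (ikl) = -exp (-π)` is real, the interference terms of the
two ends of the edge cancel and the probability flux of an outgoing solution is definite;
a unitary coupling lets no net flux into the vertex. -/
theorem charDet_ne_zero_at (Γ : OneEdgeQuantumGraph M) :
    Γ.charDet ((Real.pi / Γ.length : ℝ) * (1 + Complex.I)) ≠ 0 := by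
  set τ : ℝ := Real.pi / Γ.length with hτ
  have hl := Γ.length_pos
  have hτ0 : 0 < τ := div_pos Real.pi_pos hl
  have hτl : τ * Γ.length = Real.pi := by rw [hτ]; field_simp
  set k : ℂ := τ * (1 + Complex.I) with hk
  have hkl : Complex.I * k * Γ.length = Real.pi * Complex.I + (-Real.pi : ℝ) := by
    rw [← hτl, hk]
    push_cast
    linear_combination (τ * Γ.length : ℂ) * Complex.I_sq
  have hE : Complex.exp (Complex.I * k * Γ.length) = -(Real.exp (-Real.pi) : ℝ) := by
    rw [hkl, Complex.exp_add, Complex.exp_pi_mul_I, Complex.ofReal_exp]; ring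
  have hE' : Complex.exp (-(Complex.I * k * Γ.length)) = -(Real.exp Real.pi : ℝ) := by
    rw [Complex.exp_neg, hE, Real.exp_neg]
    push_cast
    rw [inv_neg, inv_inv]
  rw [Ne, charDet_eq_zero_iff]
  rintro ⟨a, b, c, hne, h⟩
  set ε := Complex.exp (-(Complex.I * Γ.flux)) with hε
  have hεn : Complex.normSq ε = 1 := by
    rw [Complex.normSq_eq_norm_sq, hε, Complex.norm_exp]; simp
  simp only [outgoingColumn, incomingColumn, hE, hE', Pi.add_apply, Pi.smul_apply,
    smul_eq_mul, ← hε] at h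
  set a' : ℂ := -(Real.exp (-Real.pi) : ℝ) * a with ha'
  set b' : ℂ := -(Real.exp Real.pi : ℝ) * b with hb'
  -- the vectors `Ψ + i (Ψ' + i 𝒜 Ψ)` and `Ψ - i (Ψ' + i 𝒜 Ψ)`
  have hUv : Γ.coupling *ᵥ Sum.elim ![(1 - k) * a + (1 + k) * b,
      ε * ((1 - k) * b' + (1 + k) * a')] (fun m => (1 - k) * c m) =
      Sum.elim ![(1 + k) * a + (1 - k) * b,
      ε * ((1 + k) * b' + (1 - k) * a')] (fun m => (1 + k) * c m) := by
    funext i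
    have hs : ∑ m, c m * couplingColumn Γ.coupling k (Sum.inr m) i =
        ∑ m, Γ.coupling i (Sum.inr m) * ((1 - k) * c m) -
          Sum.elim (fun _ : Fin 2 => (0 : ℂ)) (fun m => (1 + k) * c m) i := by
      have h1 : ∀ m, c m * couplingColumn Γ.coupling k (Sum.inr m) i =
          Γ.coupling i (Sum.inr m) * ((1 - k) * c m) -
          (1 + k) * ((1 : Matrix (Fin 2 ⊕ Fin M) (Fin 2 ⊕ Fin M) ℂ) i (Sum.inr m) * c m) :=
        fun m => by rw [couplingColumn]; ring
      rw [Finset.sum_congr rfl fun m _ => h1 m, Finset.sum_sub_distrib, ← Finset.mul_sum]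
      rcases i with i | i <;> simp [Matrix.one_apply]
    have hi := h i
    rw [hs] at hi
    simp only [Matrix.mulVec, dotProduct, Fintype.sum_sum_type, Fin.sum_univ_two, Sum.elim_inl,
      Sum.elim_inr, couplingColumn] at hi ⊢
    generalize ∑ m, Γ.coupling i (Sum.inr m) * ((1 - k) * c m) = σ at hi ⊢
    rcases i with i | i
    · obtain rfl | rfl : i = 0 ∨ i = 1 := by fin_cases i <;> simp
      · simp [-Complex.ofReal_exp] at hi ⊢
        linear_combination hi
      · simp [-Complex.ofReal_exp] at hi ⊢
        linear_combination hi
    · simp [-Complex.ofReal_exp] at hi ⊢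
      linear_combination hi
  have hnorm := sum_normSq_mulVec_of_mem_unitaryGroup Γ.coupling_unitary
    (Sum.elim ![(1 - k) * a + (1 + k) * b,
      ε * ((1 - k) * b' + (1 + k) * a')] (fun m => (1 - k) * c m))
  rw [hUv] at hnorm
  simp only [Fintype.sum_sum_type, Fin.sum_univ_two, Sum.elim_inl, Sum.elim_inr,
    Matrix.cons_val_zero, Matrix.cons_val_one, Complex.normSq_mul ε, hεn, one_mul] at hnorm
  have h0 := normSq_sub_normSq_eq τ a b
  have h1 := normSq_sub_normSq_eq τ b' a'
  have h2 : ∑ m, Complex.normSq ((1 - k) * c m) - ∑ m, Complex.normSq ((1 + k) * c m) =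
      -4 * τ * ∑ m, Complex.normSq (c m) := by
    rw [← Finset.sum_sub_distrib, Finset.mul_sum]
    refine Finset.sum_congr rfl fun m _ => ?_
    have := normSq_sub_normSq_eq τ (c m) 0
    simpa using this
  rw [← hk] at h0 h1
  have hexp : Real.exp (-Real.pi) * Real.exp Real.pi = 1 := by
    rw [← Real.exp_add, neg_add_cancel, Real.exp_zero]
  have ha2 : Complex.normSq a' = Real.exp (-Real.pi) ^ 2 * Complex.normSq a := by
    rw [ha', Complex.normSq_mul, Complex.normSq_neg, Complex.normSq_ofReal]; ring
  have hb2 : Complex.normSq b' = Real.exp Real.pi ^ 2 * Complex.normSq b := by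
    rw [hb', Complex.normSq_mul, Complex.normSq_neg, Complex.normSq_ofReal]; ring
  have hcross : b'.im * a'.re - b'.re * a'.im = b.im * a.re - b.re * a.im := by
    rw [ha', hb', ← Complex.ofReal_neg, ← Complex.ofReal_neg, Complex.re_ofReal_mul,
      Complex.re_ofReal_mul, Complex.im_ofReal_mul, Complex.im_ofReal_mul]
    linear_combination (b.im * a.re - b.re * a.im) * hexp
  rw [hcross, ha2, hb2] at h1
  have hq : Real.exp (-Real.pi) ^ 2 < 1 := by
    have : Real.exp (-Real.pi) < 1 := Real.exp_lt_one_iff.2 (by linarith [Real.pi_pos])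
    exact pow_lt_one₀ (Real.exp_pos _).le this two_ne_zero
  have hq' : 1 < Real.exp Real.pi ^ 2 :=
    one_lt_pow₀ (Real.one_lt_exp_iff.2 Real.pi_pos) two_ne_zero
  have hsum : (1 - Real.exp (-Real.pi) ^ 2) * Complex.normSq a +
      (Real.exp Real.pi ^ 2 - 1) * Complex.normSq b + ∑ m, Complex.normSq (c m) = 0 := by
    refine (mul_eq_zero.1 (?_ : τ * _ = 0)).resolve_left hτ0.ne'
    linear_combination (hnorm + h0 + h1 + h2) / 4
  have hA := mul_nonneg (sub_pos.2 hq).le (Complex.normSq_nonneg a)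
  have hB := mul_nonneg (sub_pos.2 hq').le (Complex.normSq_nonneg b)
  have hC : 0 ≤ ∑ m, Complex.normSq (c m) :=
    Finset.sum_nonneg fun m _ => Complex.normSq_nonneg _
  refine hne ⟨?_, ?_, funext fun m => ?_⟩
  · have : (1 - Real.exp (-Real.pi) ^ 2) * Complex.normSq a = 0 := by linarith
    exact Complex.normSq_eq_zero.1 ((mul_eq_zero.1 this).resolve_left (sub_pos.2 hq).ne')
  · have : (Real.exp Real.pi ^ 2 - 1) * Complex.normSq b = 0 := by linarith
    exact Complex.normSq_eq_zero.1 ((mul_eq_zero.1 this).resolve_left (sub_pos.2 hq').ne')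
  · have : ∑ m, Complex.normSq (c m) = 0 := by linarith
    exact Complex.normSq_eq_zero.1 ((Finset.sum_eq_zero_iff_of_nonneg
      fun m _ => Complex.normSq_nonneg _).1 this m (Finset.mem_univ m))

theorem gaugedCoupling_eq_of (Γ : OneEdgeQuantumGraph M) :
    Γ.gaugedCoupling = Matrix.of fun i j =>
      Sum.elim ![1, Complex.exp (Complex.I * Γ.flux)] (fun _ => 1) i * Γ.coupling i j *
        (Sum.elim ![1, Complex.exp (Complex.I * Γ.flux)] (fun _ => 1) j)⁻¹ := by
  have hinv : Γ.gaugeMatrix⁻¹ = Matrix.diagonal fun i =>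
      (Sum.elim ![1, Complex.exp (Complex.I * Γ.flux)] (fun _ => 1) i)⁻¹ := by
    refine Matrix.inv_eq_right_inv ?_
    rw [gaugeMatrix, Matrix.diagonal_mul_diagonal, ← Matrix.diagonal_one]
    congr 1
    funext i
    refine mul_inv_cancel₀ ?_
    rcases i with i | i
    · fin_cases i
      exacts [one_ne_zero, Complex.exp_ne_zero _]
    · exact one_ne_zero
  ext i j
  rw [gaugedCoupling, hinv, Matrix.mul_diagonal, gaugeMatrix, Matrix.diagonal_mul]
  rfl

theorem leadMatrix_eq (Γ : OneEdgeQuantumGraph M) (k : ℂ) :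
    Γ.leadMatrix k = (1 - k) • Γ.coupling.toBlocks₂₂ -
      (k + 1) • (1 : Matrix (Fin M) (Fin M) ℂ) := by
  rw [leadMatrix, gaugedCoupling_eq_of]
  congr 2
  ext i j
  simp [Matrix.toBlocks₂₂]

theorem effectiveCoupling_apply (Γ : OneEdgeQuantumGraph M) (k : ℂ) (i j : Fin 2) :
    Γ.effectiveCoupling k i j = ![1, Complex.exp (Complex.I * Γ.flux)] i *
      schurCoupling Γ.coupling k i j * (![1, Complex.exp (Complex.I * Γ.flux)] j)⁻¹ := by
  rw [effectiveCoupling, schurCoupling, leadMatrix_eq, gaugedCoupling_eq_of]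
  simp only [Matrix.sub_apply, Matrix.smul_apply, Matrix.mul_apply, Matrix.toBlocks₁₁,
    Matrix.toBlocks₁₂, Matrix.toBlocks₂₁, Matrix.of_apply, Sum.elim_inl, Sum.elim_inr, smul_eq_mul,
    inv_one, mul_one, one_mul, mul_sub, sub_mul, Finset.mul_sum, Finset.sum_mul]
  congr 1
  refine Finset.sum_congr rfl fun _ _ => Finset.sum_congr rfl fun _ _ => ?_
  ring

theorem norm_schurCoupling_eq (Γ : OneEdgeQuantumGraph M) (k : ℂ)
    (h : ‖Γ.effectiveCoupling k 0 1‖ = ‖Γ.effectiveCoupling k 1 0‖) :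
    ‖schurCoupling Γ.coupling k 0 1‖ = ‖schurCoupling Γ.coupling k 1 0‖ := by
  have hn : ‖Complex.exp (Complex.I * Γ.flux)‖ = 1 := by simp [Complex.norm_exp]
  simpa [effectiveCoupling_apply, hn] using h

theorem charDet_eq (Γ : OneEdgeQuantumGraph M) :
    Γ.charDet = expPoly Γ.length
      (Polynomial.C (Complex.exp (-(Complex.I * Γ.flux))) *
        endPoly Γ.coupling (-Polynomial.X) 1 (-Polynomial.X) 0)
      (Polynomial.C (Complex.exp (-(Complex.I * Γ.flux))) *
        endPoly Γ.coupling Polynomial.X 0 Polynomial.X 1)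
      (endPoly Γ.coupling Polynomial.X 0 (-Polynomial.X) 0 +
        Polynomial.C (Complex.exp (-(Complex.I * Γ.flux)) ^ 2) *
          endPoly Γ.coupling (-Polynomial.X) 1 Polynomial.X 1) := by
  funext k
  rw [charDet_eq_expPoly, expPoly]
  simp only [Polynomial.eval_mul, Polynomial.eval_add, Polynomial.eval_C]
  ring

theorem resonances_eq (Γ : OneEdgeQuantumGraph M) :
    Γ.resonances = {k | k ≠ 0 ∧ Γ.charDet k = 0} :=
  Set.ext fun k => Γ.isResonance_iff k

/-- The asymptotic bound on the count, extended to all radii by monotonicity. Replacing `W` by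
`max W 0` keeps the slope nonnegative. -/
theorem exists_resonanceCount_le {Γ : OneEdgeQuantumGraph M} {W : ℝ}
    (h : Γ.HasEffectiveSize W) :
    ∃ C : ℝ, ∀ t : ℝ, 0 < t → (Γ.resonanceCount t : ℝ) ≤ 2 / Real.pi * max W 0 * t + C := by
  obtain ⟨K, hK⟩ := h.bound
  obtain ⟨t₀, ht₀⟩ := Filter.eventually_atTop.1 hK
  have hd : Differentiable ℂ Γ.charDet := by
    rw [charDet_eq]; exact differentiable_expPoly _ _ _ _
  have hmono : ∀ s t : ℝ, s ≤ t → Γ.resonanceCount s ≤ Γ.resonanceCount t := by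
    have hfin : ∀ t, (Γ.resonances ∩ Metric.ball 0 t).Finite := fun t =>
      (finite_zeros_inter_closedBall hd Γ.charDet_ne_zero_at t).subset (by
        rw [resonances_eq]
        exact Set.inter_subset_inter (fun k hk => hk.2) Metric.ball_subset_closedBall)
    intro s t hst
    rw [resonanceCount, resonanceCount, finsum_mem_eq_finite_toFinset_sum _ (hfin s),
      finsum_mem_eq_finite_toFinset_sum _ (hfin t)]
    refine Finset.sum_le_sum_of_subset ?_
    rw [Set.Finite.toFinset_subset_toFinset]
    exact Set.inter_subset_inter_right _ (Metric.ball_subset_ball hst)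
  have hpi : 0 ≤ 2 / Real.pi := by positivity
  have hlarge : ∀ t, t₀ ≤ t → 0 < t →
      (Γ.resonanceCount t : ℝ) ≤ 2 / Real.pi * max W 0 * t + K := by
    intro t ht ht0
    have h1 := ht₀ t ht
    rw [norm_one, mul_one, Real.norm_eq_abs] at h1
    have h2 : 2 / Real.pi * W * t ≤ 2 / Real.pi * max W 0 * t := by
      gcongr
      exact le_max_left _ _
    linarith [(abs_le.1 h1).2]
  set t₁ := max t₀ 1 with ht₁
  have ht₁0 : 0 < t₁ := lt_of_lt_of_le one_pos (le_max_right _ _)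
  refine ⟨|K| + 2 / Real.pi * max W 0 * t₁, fun t ht0 => ?_⟩
  have hW : 0 ≤ max W 0 := le_max_right _ _
  have hp1 : 0 ≤ 2 / Real.pi * max W 0 * t₁ := by positivity
  have hp2 : 0 ≤ 2 / Real.pi * max W 0 * t := by positivity
  rcases le_total t₁ t with ht | ht
  · have := hlarge t ((le_max_left _ _).trans ht) ht0
    linarith [le_abs_self K]
  · have h1 := hlarge t₁ (le_max_left _ _) ht₁0
    have h2 : (Γ.resonanceCount t : ℝ) ≤ Γ.resonanceCount t₁ := Nat.cast_le.2 (hmono t t₁ ht)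
    linarith [le_abs_self K]

theorem endPoly_eq_zero_of_isNonWeyl {Γ : OneEdgeQuantumGraph M} (hΓ : Γ.IsNonWeyl) :
    endPoly Γ.coupling (-Polynomial.X) 1 (-Polynomial.X) 0 = 0 ∨
      endPoly Γ.coupling Polynomial.X 0 Polynomial.X 1 = 0 := by
  obtain ⟨W, hW, hsize⟩ := hΓ
  obtain ⟨C, hC⟩ := exists_resonanceCount_le hsize
  by_contra! hne
  have hε : Polynomial.C (Complex.exp (-(Complex.I * Γ.flux))) ≠ 0 := by
    rw [Ne, Polynomial.C_eq_zero]; exact Complex.exp_ne_zero _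
  have h := two_mul_le_of_count_le Γ.length_pos
    (endPoly Γ.coupling Polynomial.X 0 (-Polynomial.X) 0 +
        Polynomial.C (Complex.exp (-(Complex.I * Γ.flux)) ^ 2) *
          endPoly Γ.coupling (-Polynomial.X) 1 Polynomial.X 1)
    (mul_ne_zero hε hne.1) (mul_ne_zero hε hne.2) (c := 2 / Real.pi * max W 0) (C := C)
    (mul_nonneg (by positivity) (le_max_right _ _)) (by
      rw [← charDet_eq, ← resonances_eq]
      exact hC)
  have hpi := Real.pi_pos
  have h2 : Real.pi * (2 / Real.pi * max W 0) = 2 * max W 0 := by field_simp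
  rw [h2] at h
  have := max_lt hW Γ.length_pos
  linarith

theorem finite_resonances_of_flux {Γ : OneEdgeQuantumGraph M}
    (h₀ : endPoly Γ.coupling Polynomial.X 0 (-Polynomial.X) 0 +
      Polynomial.C (Complex.exp (-(Complex.I * Γ.flux)) ^ 2) *
        endPoly Γ.coupling (-Polynomial.X) 1 Polynomial.X 1 = 0)
    (hpq : endPoly Γ.coupling (-Polynomial.X) 1 (-Polynomial.X) 0 = 0 ∨
      endPoly Γ.coupling Polynomial.X 0 Polynomial.X 1 = 0) :
    Γ.resonances.Finite := by
  rw [resonances_eq]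
  have hdet := Γ.charDet_eq
  rw [h₀] at hdet
  have hw := Γ.charDet_ne_zero_at
  have hfin : ∀ P : Polynomial ℂ, ∀ e : ℂ → ℂ, (∀ k, e k ≠ 0) →
      (∀ k, Γ.charDet k = e k * P.eval k) → {k | k ≠ 0 ∧ Γ.charDet k = 0}.Finite := by
    intro P e he hP
    have hP0 : P ≠ 0 := by
      rintro rfl
      exact hw (by rw [hP]; simp)
    refine (P.rootSet_finite ℂ).subset fun k hk => ?_
    rw [Polynomial.mem_rootSet, Polynomial.coe_aeval_eq_eval]
    have := hk.2
    rw [hP] at this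
    exact ⟨hP0, (mul_eq_zero.1 this).resolve_left (he k)⟩
  rcases hpq with h | h
  · exact hfin (Polynomial.C (Complex.exp (-(Complex.I * Γ.flux))) *
        endPoly Γ.coupling Polynomial.X 0 Polynomial.X 1)
      (fun k => Complex.exp (-(Complex.I * k * Γ.length)))
      (fun k => Complex.exp_ne_zero _) fun k => by rw [hdet, h]; simp [expPoly]
  · exact hfin (Polynomial.C (Complex.exp (-(Complex.I * Γ.flux))) *
        endPoly Γ.coupling (-Polynomial.X) 1 (-Polynomial.X) 0)
      (fun k => Complex.exp (Complex.I * k * Γ.length))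
      (fun k => Complex.exp_ne_zero _) fun k => by rw [hdet, h]; simp [expPoly]

end OneEdgeQuantumGraph

theorem theorem3 {M : ℕ} (Γ : OneEdgeQuantumGraph M) (hΓ : Γ.IsNonWeyl)
    (hU : ∀ k : ℂ, IsUnit (Γ.leadMatrix k) →
      ‖Γ.effectiveCoupling k 0 1‖ = ‖Γ.effectiveCoupling k 1 0‖) :
    ∃ Φ : ℝ, ∀ (A : ℝ → ℝ) (hA : ContDiffOn ℝ 1 A (Set.Icc 0 Γ.length)),
      (Γ.withPotential A hA).flux = Φ → (Γ.withPotential A hA).resonances.Finite := by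
  obtain ⟨Φ, hΦ⟩ := exists_phase_of_norm_eval_eq
    (α := endPoly Γ.coupling Polynomial.X 0 (-Polynomial.X) 0)
    (β := endPoly Γ.coupling (-Polynomial.X) 1 Polynomial.X 1)
    (finite_not_isUnit_lead Γ.coupling.toBlocks₂₂) (fun k hk => by
      have hL : IsUnit ((1 - k) • Γ.coupling.toBlocks₂₂ -
        (k + 1) • (1 : Matrix (Fin M) (Fin M) ℂ)) := by simpa using hk
      exact norm_eval_endPoly_eq Γ.coupling hL
        (Γ.norm_schurCoupling_eq k (hU k (by rwa [Γ.leadMatrix_eq]))))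
  have hpq := OneEdgeQuantumGraph.endPoly_eq_zero_of_isNonWeyl hΓ
  refine ⟨Φ, fun A hA hflux => ?_⟩
  refine OneEdgeQuantumGraph.finite_resonances_of_flux (Γ := Γ.withPotential A hA) ?_ hpq
  rw [hflux]
  have hexp : Complex.exp (-(Complex.I * Φ)) * Complex.exp (Complex.I * Φ) = 1 := by
    rw [← Complex.exp_add, neg_add_cancel, Complex.exp_zero]
  have hC := congrArg Polynomial.C hexp
  rw [Polynomial.C_mul, Polynomial.C_1] at hC
  change endPoly Γ.coupling Polynomial.X 0 (-Polynomial.X) 0 +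
    Polynomial.C (Complex.exp (-(Complex.I * Φ)) ^ 2) *
      endPoly Γ.coupling (-Polynomial.X) 1 Polynomial.X 1 = 0
  rw [Polynomial.C_pow]
  linear_combination Polynomial.C (Complex.exp (-(Complex.I * Φ))) * hΦ -
    endPoly Γ.coupling Polynomial.X 0 (-Polynomial.X) 0 * hC
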